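/- Let $f:\mathbb{R}^n\to\mathbb{R}^n$ be a polynomial vector field and let $X=\{x\in\mathbb{R}^n : g_i(x)\ge 0,\ i=1,\dots,m\}$, with polynomials $g_i$, be nonempty and compact; put $\partial X:=X\setminus\operatorname{int}X$. For $x_0\in\operatorname{int}X$ let $x(\cdot\,|\,x_0)$ be the maximal solution of $\dot x=f(x)$, $x(0)=x_0$. Let $X_\infty$ be the set of $x_0\in\operatorname{int}X$ such that $x(s\,|\,x_0)$ exists and lies in $\operatorname{int}X$ for all $s\ge 0$, and let $X_\infty^c:=\operatorname{int}X\setminus X_\infty$. For $x_0\in X_\infty^c$ let $\tau(x_0):=\inf\{t\ge 0 : x(t\,|\,x_0)\notin\operatorname{int}X\}$. Let $\lambda$ be the $n$-dimensional Lebesgue measure restricted to $X$ and let $\bar\tau:=\frac{1}{\lambda(X)}\int_{X_\infty^c}\tau\,d\lambda$ (with $\bar\tau:=0$ if $\lambda(X)=0$). Assume that $\bar\tau<\infty$, that $T\in[0,\infty)$ satisfies $T\ge\bar\tau$, and that trajectories strictly enter $X$ where $X_\infty$ touches $\partial X$: for every $x\in\overline{X_\infty}\cap\partial X$ at which $\partial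 X$ has an outer unit normal $n(x)$ (i.e. near $x$ one has $X=\{\rho\le 0\}$ for a $C^1$ function $\rho$ with $\rho(x)=0$ and $\nabla\rho(x)$ a positive multiple of the unit vector $n(x)$), one has $f(x)\cdot n(x)<0$. Consider the linear program $$p^T:=\sup\ \mu_0(X)\quad\text{s.t.}\quad \operatorname{div}(f\mu)+\mu_\partial=\mu_0,\qquad \mu_0+\hat\mu_0=\lambda,\qquad \mu(X)\le T\,\lambda(X),$$ over finite nonnegative Borel measures $\mu_0,\hat\mu_0,\mu$ on $X$ and $\mu_\partial$ on $\partial X$, where the first constraint means that $-\int\nabla v\cdot f\,d\mu+\int v\,d\mu_\partial=\int v\,d\mu_0$ for all $v\in C^1(\mathbb{R}^n)$. Then $p^T=\lambda(X_\infty^c)$, the supremum is attained, and the $\mu_0$ component of every optimal solution is the Lebesgue measure restricted to $X_\infty^c$. -/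

import Mathlib

open MeasureTheory Set Topology
open scoped NNReal ENNReal

namespace MPI

/-- The state space `ℝⁿ` with its Euclidean norm. -/
abbrev State (n : ℕ) : Type := EuclideanSpace ℝ (Fin n)

/-- The polynomial vector field on `ℝⁿ` with components `f 0, …, f (n-1)`. -/
noncomputable def vectorField {n : ℕ} (f : Fin n → MvPolynomial (Fin n) ℝ) (x : State n) :
    State n :=
  WithLp.toLp 2 fun i => MvPolynomial.eval (fun j => x j) (f i)

/-- The basic closed semi-algebraic set `{x | g₁ x ≥ 0, …, g_m x ≥ 0}`. -/
def semialgebraicSet {n m : ℕ} (g : Fin m → MvPolynomial (Fin n) ℝ) : Set (State n) :=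
  {x | ∀ i, 0 ≤ MvPolynomial.eval (fun j => x j) (g i)}

/-- The boundary `∂X = X \ int X`. -/
def boundary {n : ℕ} (X : Set (State n)) : Set (State n) := X \ interior X

/-- `SolutionAt F x₀ s y` means `x(s | x₀) = y`: there is a solution of `ẋ = F x` on `[0, s]` that
starts at `x₀` and is at `y` at time `s`. (For a locally Lipschitz `F`, such as a polynomial one,
solutions are unique, so there is at most one such `y`; there is none exactly when the maximal
solution has ceased to exist by time `s`.) -/
def SolutionAt {n : ℕ} (F : State n → State n) (x₀ : State n) (s : ℝ≥0) (y : State n) : Prop :=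
  ∃ γ : ℝ → State n, γ 0 = x₀ ∧ IsIntegralCurveOn γ (fun _ => F) (Icc 0 (s : ℝ)) ∧ γ s = y

/-- `X_t = {x₀ ∈ int X | ∀ s ∈ [0, t], x(s | x₀) ∈ int X}`, for `t ∈ [0, ∞]` (`s` is finite). -/
def stayingSet {n : ℕ} (F : State n → State n) (X : Set (State n)) (t : ℝ≥0∞) :
    Set (State n) :=
  {x₀ ∈ interior X | ∀ s : ℝ≥0, (s : ℝ≥0∞) ≤ t → ∃ y ∈ interior X, SolutionAt F x₀ s y}

/-- The maximal positively invariant set `X_∞`. -/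
def mpiSet {n : ℕ} (F : State n → State n) (X : Set (State n)) : Set (State n) :=
  stayingSet F X ⊤

/-- The complementary set `X_∞ᶜ = int X \ X_∞`. -/
def mpiCompl {n : ℕ} (F : State n → State n) (X : Set (State n)) : Set (State n) :=
  interior X \ mpiSet F X

/-- The exit time `τ(x₀) = inf {t ≥ 0 | x(t | x₀) ∉ int X}`, with values in `[0, ∞]`. -/
noncomputable def exitTime {n : ℕ} (F : State n → State n) (X : Set (State n)) (x₀ : State n) :
    ℝ≥0∞ :=
  sInf {t : ℝ≥0∞ | ∃ s : ℝ≥0, t = s ∧ ∃ y, y ∉ interior X ∧ SolutionAt F x₀ s y}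

/-- The average exit time `τ̄ = (1 / λ(X)) ∫_{X_∞ᶜ} τ dλ ∈ [0, ∞]`. (If `λ(X) = 0`, it is `0`.) -/
noncomputable def meanExitTime {n : ℕ} (F : State n → State n) (X : Set (State n)) : ℝ≥0∞ :=
  (∫⁻ x in mpiCompl F X, exitTime F X x) / volume X

/-- `ν` is the unit normal vector at `x` to `∂X` pointing out of `X`: near `x`, the set `X` is
`{ρ ≤ 0}` for a `C¹` function `ρ` that vanishes at `x` and whose gradient at `x` is a positive
multiple of the unit vector `ν`. -/
def IsOuterUnitNormal {n : ℕ} (X : Set (State n)) (x ν : State n) : Prop :=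
  ‖ν‖ = 1 ∧ ∃ (ρ : State n → ℝ) (c : ℝ), 0 < c ∧ ContDiffAt ℝ 1 ρ x ∧ ρ x = 0 ∧
    HasGradientAt ρ (c • ν) x ∧ ∀ᶠ y in 𝓝 x, y ∈ X ↔ ρ y ≤ 0

/-- Trajectories strictly enter `X` where `X_∞` touches `∂X`: `F x · ν < 0` for the outer unit
normal `ν` to `∂X` at each `x ∈ cl X_∞ ∩ ∂X` that has one. -/
def StrictlyEnters {n : ℕ} (F : State n → State n) (X : Set (State n)) : Prop :=
  ∀ x ∈ closure (mpiSet F X) ∩ boundary X, ∀ ν, IsOuterUnitNormal X x ν → inner ℝ (F x) ν < 0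

/-- The decision variables of the linear program. -/
structure Quadruplet (n : ℕ) where
  /-- initial measure -/
  μ₀ : Measure (State n)
  /-- slack measure -/
  μ₀hat : Measure (State n)
  /-- occupation measure -/
  μ : Measure (State n)
  /-- exit measure on the boundary -/
  μbd : Measure (State n)

/-- Feasibility for the linear program: finite nonnegative Borel measures `μ₀`, `μ₀hat`, `μ` on `X`
and `μbd` on `∂X` with `div(F μ) + μbd = μ₀`, `μ₀ + μ₀hat = λ` on `X`, `μ(X) ≤ T λ(X)`. -/
structure Feasible {n : ℕ} (F : State n → State n) (X : Set (State n)) (T : ℝ≥0)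
    (q : Quadruplet n) : Prop where
  finite_μ₀ : IsFiniteMeasure q.μ₀
  finite_μ₀hat : IsFiniteMeasure q.μ₀hat
  finite_μ : IsFiniteMeasure q.μ
  finite_μbd : IsFiniteMeasure q.μbd
  supp_μ₀ : q.μ₀ Xᶜ = 0
  supp_μ₀hat : q.μ₀hat Xᶜ = 0
  supp_μ : q.μ Xᶜ = 0
  supp_μbd : q.μbd (boundary X)ᶜ = 0
  /-- `⟨div(F μ), v⟩ + ⟨μbd, v⟩ = ⟨μ₀, v⟩` for all `v ∈ C¹`, where
  `⟨div(F μ), v⟩ = - ∫ ∇v · F dμ`; `fderiv ℝ v x (F x)` is `∇v(x) · F(x)`. -/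
  div_eq : ∀ v : State n → ℝ, ContDiff ℝ 1 v →
    -(∫ x, fderiv ℝ v x (F x) ∂q.μ) + ∫ x, v x ∂q.μbd = ∫ x, v x ∂q.μ₀
  add_eq : q.μ₀ + q.μ₀hat = volume.restrict X
  mass_le : q.μ X ≤ T * volume X

/-- The value `p^T = sup μ₀(X)` over feasible quadruplets. -/
noncomputable def primalValue {n : ℕ} (F : State n → State n) (X : Set (State n)) (T : ℝ≥0) :
    ℝ≥0∞ :=
  sSup {p : ℝ≥0∞ | ∃ q : Quadruplet n, Feasible F X T q ∧ q.μ₀ X = p}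

/-- `q` is an optimal solution: it is feasible and attains the supremum. -/
def IsOptimal {n : ℕ} (F : State n → State n) (X : Set (State n)) (T : ℝ≥0)
    (q : Quadruplet n) : Prop :=
  Feasible F X T q ∧ q.μ₀ X = primalValue F X T

end MPI

/-!
Why the theorem holds. Let `A = mpiCompl F X` and let `λ` be Lebesgue measure on `X`.

*The value `λ(A)` is feasible.* Start from `λ` restricted to `A`, follow each trajectory until it
leaves `interior X`, let `μ` measure the time spent on the way and `μbd` the exit points. The
divergence equation is the fundamental theorem of calculus along trajectories
(`IsGlobalFlow.exitQuadruplet_div_eq`), and the total mass of `μ` is the integral of the exit time,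
which the bound `T` on its mean allows.

*No feasible `μ₀` exceeds `λ` restricted to `A`.* As `μ₀ ≤ λ` and the boundary of `X` is a
Lebesgue-null set (`volume_boundary_semialgebraicSet`), this amounts to `μ₀ X_∞ = 0` for
`X_∞ = mpiSet F X`. Let `φ` be the flow. The equation `div(F μ) + μbd = μ₀` transported along `φ`
reads
`(φ t)_* μ + ∫₀ᵗ (φ s)_* μ₀ ds = μ + ∫₀ᵗ (φ s)_* μbd ds`
(`IsGlobalFlow.map_add_flowAverage`). It is evaluated on `φ t X_∞`. A point that reaches this set
within time `t` is in `X_∞`, hence not on the boundary, so the last term vanishes. The first one is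
`μ X_∞`, and `μ (φ t X_∞) ≤ μ X_∞ < ∞` by invariance. So the second term vanishes, which gives
`μ₀ (φ t X_∞) = 0` for every `t > 0`. Since `interior X` is open, each point of `X_∞` has been in
`X_∞` for a short time already, that is, `X_∞` is the union of the sets `φ t X_∞` over `t > 0`
(`IsGlobalFlow.source_eq_zero_of_forwardInvariant`).

An optimal `μ₀` is then a measure below `λ` restricted to `A` with the same finite mass, hence
equal to it.

The polynomial field is multiplied by a bump function equal to `1` on `X`, which makes its flow
global without changing anything inside `X`. The flow is only used as a Lipschitz map: where test
functions composed with it would have to be `C¹`, they are composed with Euler steps instead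
(`IsGlobalFlow.integral_comp_sub_integral`).
-/

namespace MPI

/-! ### Global flows of bounded Lipschitz vector fields -/

section Flow

variable {E : Type*} [NormedAddCommGroup E] [NormedSpace ℝ E]

/-- `φ` is the global flow of the autonomous vector field `F`: the curve `t ↦ φ t x` is the
integral curve of `F` through `x`, defined for all times, negative ones included. -/
structure IsGlobalFlow (F : E → E) (φ : ℝ → E → E) : Prop where
  zero : ∀ x, φ 0 x = x
  isIntegralCurve : ∀ x, IsIntegralCurve (fun t => φ t x) (fun _ => F)

theorem isIntegralCurve_comp_neg {F : E → E} {γ : ℝ → E}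
    (h : IsIntegralCurve γ (fun _ => F)) :
    IsIntegralCurve (fun t => γ (-t)) (fun _ x => -F x) := by
  intro t
  have := (h (-t)).scomp t (hasDerivAt_neg t)
  simpa using! this

/-- Integral curves on `[0, b]` separate at most exponentially. -/
theorem dist_integralCurveOn_le {F : E → E} {K : ℝ≥0} (hF : LipschitzWith K F)
    {γ γ' : ℝ → E} {b : ℝ}
    (h : IsIntegralCurveOn γ (fun _ => F) (Icc 0 b))
    (h' : IsIntegralCurveOn γ' (fun _ => F) (Icc 0 b)) {t : ℝ} (ht : t ∈ Icc 0 b) :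
    dist (γ t) (γ' t) ≤ dist (γ 0) (γ' 0) * Real.exp (K * t) := by
  have key : ∀ {γ : ℝ → E}, IsIntegralCurveOn γ (fun _ => F) (Icc 0 b) →
      ∀ t ∈ Ico 0 b, HasDerivWithinAt γ (F (γ t)) (Ici t) t := by
    intro γ h t ht
    exact (h t (Ico_subset_Icc_self ht)).mono_of_mem_nhdsWithin (Icc_mem_nhdsGE_of_mem ht)
  have := dist_le_of_trajectories_ODE (v := fun _ => F) (K := K) (fun _ => hF)
    (fun t ht => (h t ht).continuousWithinAt) (key h)
    (fun t ht => (h' t ht).continuousWithinAt) (key h') le_rfl t ht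
  simpa using this

namespace IsGlobalFlow

variable {F : E → E} {φ : ℝ → E → E} {K C : ℝ≥0}

theorem dist_le (h : IsGlobalFlow F φ) (hF : LipschitzWith K F) (t : ℝ) (x y : E) :
    dist (φ t x) (φ t y) ≤ dist x y * Real.exp (K * |t|) := by
  rcases le_total 0 t with ht | ht
  · have := dist_integralCurveOn_le hF ((h.isIntegralCurve x).isIntegralCurveOn (Icc 0 t))
      ((h.isIntegralCurve y).isIntegralCurveOn (Icc 0 t)) (right_mem_Icc.2 ht)
    simpa [h.zero, abs_of_nonneg ht] using this
  · have := dist_integralCurveOn_le (F := fun x => -F x) (K := K) hF.neg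
      ((isIntegralCurve_comp_neg (h.isIntegralCurve x)).isIntegralCurveOn (Icc 0 (-t)))
      ((isIntegralCurve_comp_neg (h.isIntegralCurve y)).isIntegralCurveOn (Icc 0 (-t)))
      (right_mem_Icc.2 (neg_nonneg.2 ht))
    simpa [h.zero, abs_of_nonpos ht] using this

theorem eq_of_isIntegralCurve (h : IsGlobalFlow F φ) (hF : LipschitzWith K F) {γ : ℝ → E}
    (hγ : IsIntegralCurve γ (fun _ => F)) (t : ℝ) : γ t = φ t (γ 0) := by
  rw [← dist_le_zero]
  rcases le_total 0 t with ht | ht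
  · have := dist_integralCurveOn_le hF (hγ.isIntegralCurveOn (Icc 0 t))
      ((h.isIntegralCurve (γ 0)).isIntegralCurveOn (Icc 0 t)) (right_mem_Icc.2 ht)
    simpa [h.zero] using this
  · have := dist_integralCurveOn_le (F := fun x => -F x) (K := K) hF.neg
      ((isIntegralCurve_comp_neg hγ).isIntegralCurveOn (Icc 0 (-t)))
      ((isIntegralCurve_comp_neg (h.isIntegralCurve (γ 0))).isIntegralCurveOn (Icc 0 (-t)))
      (right_mem_Icc.2 (neg_nonneg.2 ht))
    simpa [h.zero] using this

theorem add (h : IsGlobalFlow F φ) (hF : LipschitzWith K F) (s t : ℝ) (x : E) :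
    φ (s + t) x = φ s (φ t x) := by
  have hγ : IsIntegralCurve (fun s => φ (s + t) x) (fun _ => F) := fun s =>
    (h.isIntegralCurve x (s + t)).comp_add_const s t
  have := h.eq_of_isIntegralCurve hF hγ s
  simpa using this

theorem neg_apply_apply (h : IsGlobalFlow F φ) (hF : LipschitzWith K F) (t : ℝ) (x : E) :
    φ (-t) (φ t x) = x := by
  rw [← h.add hF, neg_add_cancel, h.zero]

theorem apply_neg_apply (h : IsGlobalFlow F φ) (hF : LipschitzWith K F) (t : ℝ) (x : E) :
    φ t (φ (-t) x) = x := by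
  rw [← h.add hF, add_neg_cancel, h.zero]

theorem norm_sub_le (h : IsGlobalFlow F φ) (hC : ∀ x, ‖F x‖ ≤ C) (s t : ℝ) (x : E) :
    ‖φ t x - φ s x‖ ≤ C * |t - s| := by
  have := convex_univ.norm_image_sub_le_of_norm_hasDerivWithin_le (f := fun t => φ t x)
    (fun t _ => (h.isIntegralCurve x t).hasDerivWithinAt) (fun t _ => hC (φ t x))
    (mem_univ s) (mem_univ t)
  simpa using this

theorem continuous_time (h : IsGlobalFlow F φ) (x : E) : Continuous fun t => φ t x :=
  continuous_iff_continuousAt.2 fun t => (h.isIntegralCurve x t).continuousAt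

theorem continuous_space (h : IsGlobalFlow F φ) (hF : LipschitzWith K F) (t : ℝ) :
    Continuous (φ t) := by
  refine (LipschitzWith.of_dist_le_mul
    (K := ⟨Real.exp (K * |t|), (Real.exp_pos _).le⟩) ?_).continuous
  intro x y
  rw [mul_comm]
  exact h.dist_le hF t x y

theorem continuous_uncurry (h : IsGlobalFlow F φ) (hF : LipschitzWith K F)
    (hC : ∀ x, ‖F x‖ ≤ C) : Continuous fun p : ℝ × E => φ p.1 p.2 := by
  have h1 : ∀ x : E, LipschitzWith C fun t => φ t x := fun x =>
    LipschitzWith.of_dist_le_mul fun t s => by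
      rw [dist_eq_norm, Real.dist_eq]; exact h.norm_sub_le hC s t x
  exact continuous_prod_of_continuous_lipschitzWith _ C (h.continuous_space hF) h1

end IsGlobalFlow

/-- A bounded Lipschitz vector field has a global flow. As the field is bounded, the
Picard–Lindelöf theorem applies on every time interval `[-T, T]` at once, on a ball of radius
proportional to `T`. -/
theorem exists_isGlobalFlow [CompleteSpace E] {F : E → E} {K C : ℝ≥0} (hF : LipschitzWith K F)
    (hC : ∀ x, ‖F x‖ ≤ C) : ∃ φ, IsGlobalFlow F φ := by
  have hloc : ∀ (x : E) (N : ℕ), ∃ γ : ℝ → E, γ 0 = x ∧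
      ∀ t ∈ Icc (-(N : ℝ)) N, HasDerivWithinAt γ (F (γ t)) (Icc (-(N : ℝ)) N) t := by
    intro x N
    have hpl : IsPicardLindelof (fun _ : ℝ => F) (tmin := -(N : ℝ)) (tmax := N)
        ⟨0, by simp⟩ x (C * N) 0 C K :=
      IsPicardLindelof.of_time_independent (fun x _ => hC x) hF.lipschitzOnWith (by simp)
    exact hpl.exists_eq_forall_mem_Icc_hasDerivWithinAt₀
  choose γ hγ0 hγ using hloc
  -- Curves for two values of `N` agree on the smaller interval.
  have hpos : ∀ (x : E) (N : ℕ), IsIntegralCurveOn (γ x N) (fun _ => F) (Icc 0 (N : ℝ)) :=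
    fun x N t ht => (hγ x N t ⟨by linarith [ht.1, N.cast_nonneg (α := ℝ)], ht.2⟩).mono
      (Icc_subset_Icc_left (by simp))
  have hneg : ∀ (x : E) (N : ℕ),
      IsIntegralCurveOn (fun t => γ x N (-t)) (fun _ x => -F x) (Icc 0 (N : ℝ)) := by
    intro x N t ht
    have h1 := (hγ x N (-t) ⟨by linarith [ht.2], by linarith [ht.1, N.cast_nonneg (α := ℝ)]⟩)
    have h2 := h1.scomp t (hasDerivAt_neg t).hasDerivWithinAt (s := Icc 0 (N : ℝ))
      (fun s hs => ⟨by linarith [hs.2], by linarith [hs.1, N.cast_nonneg (α := ℝ)]⟩)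
    simpa using! h2
  have hagree : ∀ (x : E) (M N : ℕ) (t : ℝ), |t| ≤ M → |t| ≤ N → γ x M t = γ x N t := by
    intro x M N t hM hN
    rw [← dist_le_zero]
    rcases le_total 0 t with ht | ht
    · rw [abs_of_nonneg ht] at hM hN
      have := dist_integralCurveOn_le hF ((hpos x M).mono (Icc_subset_Icc_right hM))
        ((hpos x N).mono (Icc_subset_Icc_right hN)) (right_mem_Icc.2 ht)
      simpa [hγ0] using this
    · rw [abs_of_nonpos ht] at hM hN
      have := dist_integralCurveOn_le (K := K) hF.neg ((hneg x M).mono (Icc_subset_Icc_right hM))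
        ((hneg x N).mono (Icc_subset_Icc_right hN)) (right_mem_Icc.2 (neg_nonneg.2 ht))
      simpa [hγ0] using this
  refine ⟨fun t x => γ x ⌈|t|⌉₊ t, fun x => hγ0 x _, fun x t => ?_⟩
  obtain ⟨N, hN⟩ := exists_nat_gt |t|
  have hN' := abs_lt.1 hN
  have hd : HasDerivAt (γ x N) (F (γ x N t)) t :=
    (hγ x N t ⟨hN'.1.le, hN'.2.le⟩).hasDerivAt (Icc_mem_nhds hN'.1 hN'.2)
  have heq : (fun s => γ x ⌈|s|⌉₊ s) =ᶠ[𝓝 t] γ x N := by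
    filter_upwards [continuous_abs.continuousAt.eventually_lt continuousAt_const hN] with s hs
    exact hagree x _ N s (Nat.le_ceil _) hs.le
  have := hd.congr_of_eventuallyEq heq
  rw [← heq.eq_of_nhds] at this
  exact this

end Flow

/-! ### Explicit Euler steps -/

section Euler

variable {E : Type*} [NormedAddCommGroup E] [NormedSpace ℝ E]

/-- The explicit Euler step of length `h` for `ẋ = F x`. -/
def eulerStep (F : E → E) (h : ℝ) (x : E) : E := x + h • F x

/-- `v` is `C¹`, its differential is bounded by `M` and Lipschitz with constant `Λ`. -/
structure HasC11Bound (v : E → ℝ) (M Λ : ℝ) : Prop where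
  contDiff : ContDiff ℝ 1 v
  norm_fderiv_le : ∀ x, ‖fderiv ℝ v x‖ ≤ M
  norm_fderiv_sub_le : ∀ x y, ‖fderiv ℝ v x - fderiv ℝ v y‖ ≤ Λ * ‖x - y‖

variable {F : E → E} {φ : ℝ → E → E} {K C : ℝ≥0} {L M Λ h : ℝ} {v : E → ℝ}

namespace HasC11Bound

theorem mono (hv : HasC11Bound v M Λ) {M' Λ' : ℝ} (hM : M ≤ M') (hΛ : Λ ≤ Λ') :
    HasC11Bound v M' Λ' where
  contDiff := hv.contDiff
  norm_fderiv_le x := (hv.norm_fderiv_le x).trans hM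
  norm_fderiv_sub_le x y := (hv.norm_fderiv_sub_le x y).trans (by gcongr)

theorem nonneg (hv : HasC11Bound v M Λ) : 0 ≤ M := (norm_nonneg _).trans (hv.norm_fderiv_le 0)

theorem differentiable (hv : HasC11Bound v M Λ) : Differentiable ℝ v :=
  hv.contDiff.differentiable one_ne_zero

theorem abs_sub_le (hv : HasC11Bound v M Λ) (x y : E) : |v x - v y| ≤ M * ‖x - y‖ := by
  have := convex_univ.norm_image_sub_le_of_norm_fderiv_le (𝕜 := ℝ) (f := v)
    (fun x _ => hv.differentiable x) (fun x _ => hv.norm_fderiv_le x) (mem_univ y) (mem_univ x)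
  simpa using this

theorem abs_taylor_le (hv : HasC11Bound v M Λ) (hΛ : 0 ≤ Λ) (x y : E) :
    |v (x + y) - v x - fderiv ℝ v x y| ≤ Λ * ‖y‖ ^ 2 := by
  have := (convex_closedBall x ‖y‖).norm_image_sub_le_of_norm_fderiv_le' (𝕜 := ℝ) (f := v)
    (φ := fderiv ℝ v x) (C := Λ * ‖y‖) (x := x) (y := x + y)
    (fun z _ => hv.differentiable z)
    (fun z hz => (hv.norm_fderiv_sub_le z x).trans (by
      rw [mem_closedBall_iff_norm] at hz; gcongr))
    (by simp) (by simp)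
  rw [add_sub_cancel_left, Real.norm_eq_abs] at this
  exact this.trans_eq (by ring)

theorem comp_eulerStep (hF : ContDiff ℝ 1 F) (hK : LipschitzWith K F)
    (hDF : ∀ x y, ‖fderiv ℝ F x - fderiv ℝ F y‖ ≤ L * ‖x - y‖) (hh : 0 ≤ h) (hΛ : 0 ≤ Λ)
    (hv : HasC11Bound v M Λ) :
    HasC11Bound (v ∘ eulerStep F h) (M * (1 + h * K)) (Λ * (1 + h * K) ^ 2 + M * (h * L)) := by
  have hM := hv.nonneg
  have hcd : ContDiff ℝ 1 (eulerStep F h) := contDiff_id.add (hF.const_smul h)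
  have hdF : ∀ x, HasFDerivAt F (fderiv ℝ F x) x := fun x =>
    (hF.differentiable one_ne_zero x).hasFDerivAt
  have hd : ∀ x, HasFDerivAt (eulerStep F h) (ContinuousLinearMap.id ℝ E + h • fderiv ℝ F x) x :=
    fun x => (hasFDerivAt_id x).add ((hdF x).const_smul h)
  have hcomp : ∀ x, fderiv ℝ (v ∘ eulerStep F h) x =
      (fderiv ℝ v (eulerStep F h x)).comp (ContinuousLinearMap.id ℝ E + h • fderiv ℝ F x) :=
    fun x => ((hv.differentiable _).hasFDerivAt.comp x (hd x)).fderiv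
  have hJ : ∀ x, ‖ContinuousLinearMap.id ℝ E + h • fderiv ℝ F x‖ ≤ 1 + h * K := by
    intro x
    refine (norm_add_le _ _).trans (add_le_add ContinuousLinearMap.norm_id_le ?_)
    rw [norm_smul, Real.norm_of_nonneg hh]
    gcongr
    exact norm_fderiv_le_of_lipschitz ℝ hK
  have hlip : ∀ x y, ‖eulerStep F h x - eulerStep F h y‖ ≤ (1 + h * K) * ‖x - y‖ := by
    intro x y
    have : eulerStep F h x - eulerStep F h y = (x - y) + h • (F x - F y) := by
      simp only [eulerStep, smul_sub]; abel
    rw [this]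
    refine (norm_add_le _ _).trans ?_
    rw [norm_smul, Real.norm_of_nonneg hh]
    have := hK.norm_sub_le x y
    nlinarith
  refine ⟨hv.contDiff.comp hcd, fun x => ?_, fun x y => ?_⟩
  · rw [hcomp]
    refine (ContinuousLinearMap.opNorm_comp_le _ _).trans ?_
    exact mul_le_mul (hv.norm_fderiv_le _) (hJ x) (norm_nonneg _) hM
  · have hsplit : fderiv ℝ (v ∘ eulerStep F h) x - fderiv ℝ (v ∘ eulerStep F h) y =
        (fderiv ℝ v (eulerStep F h x) - fderiv ℝ v (eulerStep F h y)).comp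
          (ContinuousLinearMap.id ℝ E + h • fderiv ℝ F x) +
        (fderiv ℝ v (eulerStep F h y)).comp (h • (fderiv ℝ F x - fderiv ℝ F y)) := by
      rw [hcomp, hcomp]
      ext z
      simp only [_root_.sub_apply, _root_.add_apply,
        ContinuousLinearMap.comp_apply, _root_.smul_apply,
        ContinuousLinearMap.id_apply, map_add, map_smul, map_sub, smul_eq_mul]
      ring
    have h1 : ‖(fderiv ℝ v (eulerStep F h x) - fderiv ℝ v (eulerStep F h y)).comp
        (ContinuousLinearMap.id ℝ E + h • fderiv ℝ F x)‖ ≤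
        (Λ * ((1 + h * K) * ‖x - y‖)) * (1 + h * K) := by
      refine (ContinuousLinearMap.opNorm_comp_le _ _).trans ?_
      refine mul_le_mul ((hv.norm_fderiv_sub_le _ _).trans ?_) (hJ x) (norm_nonneg _)
        (by positivity)
      gcongr
      exact hlip x y
    have h2 : ‖(fderiv ℝ v (eulerStep F h y)).comp (h • (fderiv ℝ F x - fderiv ℝ F y))‖ ≤
        M * (h * (L * ‖x - y‖)) := by
      refine (ContinuousLinearMap.opNorm_comp_le _ _).trans ?_
      refine mul_le_mul (hv.norm_fderiv_le _) ?_ (norm_nonneg _) hM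
      rw [norm_smul, Real.norm_of_nonneg hh]
      gcongr
      exact hDF x y
    rw [hsplit]
    refine ((norm_add_le _ _).trans (add_le_add h1 h2)).trans_eq (by ring)

theorem comp_eulerStep_iterate (hF : ContDiff ℝ 1 F) (hK : LipschitzWith K F) (hL : 0 ≤ L)
    (hDF : ∀ x y, ‖fderiv ℝ F x - fderiv ℝ F y‖ ≤ L * ‖x - y‖) (hh : 0 ≤ h) (hΛ : 0 ≤ Λ)
    (hv : HasC11Bound v M Λ) (k : ℕ) :
    HasC11Bound (v ∘ (eulerStep F h)^[k]) (M * (1 + h * K) ^ k)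
      ((1 + h * K) ^ (2 * k) * (Λ + k * (h * L * M))) := by
  have hM := hv.nonneg
  have hA : 1 ≤ 1 + h * (K : ℝ) := le_add_of_nonneg_right (by positivity)
  induction k with
  | zero => simpa using hv
  | succ k ih =>
    have := ih.comp_eulerStep hF hK hDF hh (by positivity)
    rw [Function.iterate_succ, ← Function.comp_assoc]
    refine this.mono (le_of_eq (by ring)) ?_
    have hp : (1 + h * (K : ℝ)) ^ k ≤ (1 + h * K) ^ (2 * (k + 1)) :=
      pow_le_pow_right₀ hA (by omega)
    have hx : 0 ≤ h * L * M := by positivity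
    have := mul_le_mul_of_nonneg_right hp hx
    push_cast
    calc _ = (1 + h * (K : ℝ)) ^ (2 * (k + 1)) * (Λ + k * (h * L * M)) +
          (1 + h * (K : ℝ)) ^ k * (h * L * M) := by ring
      _ ≤ _ := by linarith

end HasC11Bound

theorem one_add_pow_le_exp {h t : ℝ} (hh : 0 ≤ h) (K : ℝ≥0) {k : ℕ} (hk : k * h ≤ t) :
    (1 + h * (K : ℝ)) ^ k ≤ Real.exp (K * t) := by
  have h0 : 0 ≤ h * (K : ℝ) := by positivity
  calc (1 + h * (K : ℝ)) ^ k ≤ Real.exp (h * K) ^ k := by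
        gcongr
        linarith [Real.add_one_le_exp (h * (K : ℝ))]
    _ = Real.exp (k * (h * K)) := (Real.exp_nat_mul _ _).symm
    _ ≤ _ := by
        apply Real.exp_le_exp.2
        nlinarith [K.coe_nonneg]

/-- The Euler scheme converges to the flow at first order, uniformly in the initial point. -/
theorem IsGlobalFlow.norm_sub_eulerStep_iterate_le (hφ : IsGlobalFlow F φ)
    (hK : LipschitzWith K F) (hC : ∀ x, ‖F x‖ ≤ C) (hh : 0 ≤ h) {t : ℝ} {k : ℕ}
    (hk : k * h ≤ t) (x : E) :
    ‖φ (k * h) x - (eulerStep F h)^[k] x‖ ≤ t * K * C * Real.exp (K * t) * h := by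
  have hlocal : ∀ y, ‖φ h y - eulerStep F h y‖ ≤ K * C * h ^ 2 := by
    intro y
    have hd : ∀ s ∈ Icc 0 h, HasDerivWithinAt (fun s => φ s y - (y + s • F y))
        (F (φ s y) - F y) (Icc 0 h) s := by
      intro s _
      have := ((hφ.isIntegralCurve y s).sub
        (((hasDerivAt_id s).smul_const (F y)).const_add y)).hasDerivWithinAt (s := Icc 0 h)
      simpa using! this
    have hb : ∀ s ∈ Icc 0 h, ‖F (φ s y) - F y‖ ≤ K * (C * h) := by
      intro s hs
      refine (hK.norm_sub_le _ _).trans ?_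
      gcongr
      have := hφ.norm_sub_le hC 0 s y
      rw [hφ.zero, sub_zero, abs_of_nonneg hs.1] at this
      exact this.trans (by gcongr; exact hs.2)
    have := (convex_Icc 0 h).norm_image_sub_le_of_norm_hasDerivWithin_le hd hb
      (left_mem_Icc.2 hh) (right_mem_Icc.2 hh)
    simp only [hφ.zero, zero_smul, add_zero, sub_self, sub_zero, Real.norm_of_nonneg hh] at this
    exact this.trans_eq (by ring)
  have hA : 1 ≤ 1 + h * (K : ℝ) := le_add_of_nonneg_right (by positivity)
  have main : ∀ j : ℕ, ‖φ (j * h) x - (eulerStep F h)^[j] x‖ ≤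
      j * (K * C * h ^ 2) * (1 + h * K) ^ j := by
    intro j
    induction j with
    | zero => simp [hφ.zero]
    | succ j ih =>
      have e1 : φ ((j + 1 : ℕ) * h) x = φ h (φ (j * h) x) := by
        rw [← hφ.add hK]; congr 1; push_cast; ring
      rw [e1, Function.iterate_succ_apply']
      set y := φ (j * h) x
      set z := (eulerStep F h)^[j] x
      have e2 : φ h y - eulerStep F h z =
          (φ h y - eulerStep F h y) + ((y - z) + h • (F y - F z)) := by
        simp only [eulerStep, smul_sub]; abel
      have h1 : ‖(y - z) + h • (F y - F z)‖ ≤ (1 + h * K) * ‖y - z‖ := by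
        refine (norm_add_le _ _).trans ?_
        rw [norm_smul, Real.norm_of_nonneg hh]
        have := hK.norm_sub_le y z
        nlinarith
      rw [e2]
      refine (norm_add_le _ _).trans ((add_le_add (hlocal y) h1).trans ?_)
      have h2 : (1 + h * K) * ‖y - z‖ ≤
          (1 + h * K) * (j * (K * C * h ^ 2) * (1 + h * K) ^ j) := by gcongr
      have h3 : (K * C * h ^ 2 : ℝ) ≤ K * C * h ^ 2 * (1 + h * K) ^ (j + 1) :=
        le_mul_of_one_le_right (by positivity) (one_le_pow₀ hA)
      push_cast
      calc _ ≤ K * C * h ^ 2 * (1 + h * K) ^ (j + 1) +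
            (1 + h * K) * (j * (K * C * h ^ 2) * (1 + h * K) ^ j) := add_le_add h3 h2
        _ = _ := by ring
  refine (main k).trans ?_
  have hp := one_add_pow_le_exp hh K hk
  calc _ = (k * h) * (K * C * h) * (1 + h * K) ^ k := by ring
    _ ≤ t * (K * C * h) * Real.exp (K * t) := by
        have ht : 0 ≤ t := le_trans (by positivity) hk
        gcongr
    _ = _ := by ring

end Euler

/-! ### Transport of measures along the flow -/

theorem integrable_of_continuous_of_bound {E : Type*} [TopologicalSpace E] [MeasurableSpace E]
    [BorelSpace E] {B : ℝ} (ν : Measure E) [IsFiniteMeasure ν] {u : E → ℝ}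
    (hu : Continuous u) (hB : ∀ x, |u x| ≤ B) : Integrable u ν :=
  Integrable.of_bound hu.aestronglyMeasurable B (.of_forall hB)

theorem abs_integral_sub_integral_le {E : Type*} [TopologicalSpace E] [MeasurableSpace E]
    [BorelSpace E] {B : ℝ} (ν : Measure E) [IsFiniteMeasure ν] {u w : E → ℝ} {c B' : ℝ}
    (hu : Continuous u) (hw : Continuous w) (hB : ∀ x, |u x| ≤ B) (hB' : ∀ x, |w x| ≤ B')
    (h : ∀ x, |u x - w x| ≤ c) : |∫ x, u x ∂ν - ∫ x, w x ∂ν| ≤ c * ν.real univ := by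
  rw [← integral_sub (integrable_of_continuous_of_bound ν hu hB)
    (integrable_of_continuous_of_bound ν hw hB')]
  exact norm_integral_le_of_norm_le_const (f := fun x => u x - w x) (.of_forall h)

section Transport

variable {E : Type*} [NormedAddCommGroup E] [NormedSpace ℝ E] [MeasurableSpace E] [BorelSpace E]
  {F : E → E} {φ : ℝ → E → E} {K C : ℝ≥0} {L M Λ B : ℝ} {v : E → ℝ}

/-- If `div(F μ) + ν₁ = ν₀` holds against `C¹` functions, then it holds in integrated form along the
flow. The function `v ∘ φ s` need not be known to be `C¹`, so
the equation is tested on `v` composed with iterated Euler steps of length `t / N`. By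
`HasC11Bound.comp_eulerStep_iterate` these satisfy uniform `C^{1,1}` bounds, which make the error of
each step of order `1 / N²`. -/
theorem IsGlobalFlow.integral_comp_sub_integral (hφ : IsGlobalFlow F φ)
    (hF : ContDiff ℝ 1 F) (hK : LipschitzWith K F) (hL : 0 ≤ L)
    (hDF : ∀ x y, ‖fderiv ℝ F x - fderiv ℝ F y‖ ≤ L * ‖x - y‖) (hC : ∀ x, ‖F x‖ ≤ C)
    {μ ν₀ ν₁ : Measure E} [IsFiniteMeasure μ] [IsFiniteMeasure ν₀] [IsFiniteMeasure ν₁]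
    (hdiv : ∀ w : E → ℝ, ContDiff ℝ 1 w →
      -(∫ x, fderiv ℝ w x (F x) ∂μ) + ∫ x, w x ∂ν₁ = ∫ x, w x ∂ν₀)
    (hΛ : 0 ≤ Λ) (hv : HasC11Bound v M Λ) (hB : ∀ x, |v x| ≤ B) {t : ℝ} (ht : 0 ≤ t) :
    ∫ x, v (φ t x) ∂μ - ∫ x, v x ∂μ =
      ∫ s in 0..t, (∫ x, v (φ s x) ∂ν₁ - ∫ x, v (φ s x) ∂ν₀) := by
  have hM := hv.nonneg
  have hcv : ∀ s, Continuous fun x => v (φ s x) := fun s =>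
    hv.contDiff.continuous.comp (hφ.continuous_space hK s)
  set Ψ : ℝ → ℝ := fun s => ∫ x, v (φ s x) ∂ν₁ - ∫ x, v (φ s x) ∂ν₀ with hΨ
  have hlipv : ∀ s s' x, |v (φ s x) - v (φ s' x)| ≤ M * (C * |s - s'|) := fun s s' x =>
    (hv.abs_sub_le _ _).trans (by gcongr; exact hφ.norm_sub_le hC s' s x)
  have hcontν : ∀ ν : Measure E, IsFiniteMeasure ν → Continuous fun s => ∫ x, v (φ s x) ∂ν := by
    intro ν _
    refine continuous_of_dominated (bound := fun _ => B)
      (fun s => (hcv s).aestronglyMeasurable) (fun s => .of_forall fun x => hB _)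
      (integrable_const _) (.of_forall fun x => ?_)
    exact hv.contDiff.continuous.comp (hφ.continuous_time x)
  have hΨc : Continuous Ψ := (hcontν ν₁ inferInstance).sub (hcontν ν₀ inferInstance)
  -- uniform constants for the composed test functions and for the Euler error
  set M' : ℝ := M * Real.exp (K * t) with hM'
  set Λ' : ℝ := Real.exp (K * t) ^ 2 * (Λ + t * L * M) with hΛ'
  set D : ℝ := t * K * C * Real.exp (K * t) with hD
  have hΛ'0 : 0 ≤ Λ' := by positivity
  have hD0 : 0 ≤ D := by positivity
  set G : ℝ := Λ' * C ^ 2 * μ.real univ + M * (C + D) * (ν₁.real univ + ν₀.real univ) with hG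
  have hG0 : 0 ≤ G := by positivity
  have hN : ∀ N : ℕ, 0 < N →
      |∫ x, v (φ t x) ∂μ - ∫ x, v x ∂μ - ∫ s in 0..t, Ψ s| ≤
        (t ^ 2 * G + M * D * t * μ.real univ) / N := by
    intro N hNpos
    have hNpos' : (0 : ℝ) < N := by exact_mod_cast hNpos
    set h : ℝ := t / N with hh
    have hh0 : 0 ≤ h := by positivity
    have hNh : N * h = t := by rw [hh]; field_simp
    have hkh : ∀ {k : ℕ}, k ≤ N → k * h ≤ t := fun {k} hk => by
      rw [← hNh]; gcongr
    set w : ℕ → E → ℝ := fun k => v ∘ (eulerStep F h)^[k] with hw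
    have hwB : ∀ k x, |w k x| ≤ B := fun k x => hB _
    have hwC : ∀ k, k ≤ N → HasC11Bound (w k) M' Λ' := by
      intro k hk
      refine (hv.comp_eulerStep_iterate hF hK hL hDF hh0 hΛ k).mono ?_ ?_
      · exact mul_le_mul_of_nonneg_left (one_add_pow_le_exp hh0 K (hkh hk)) hM
      · have h1 := one_add_pow_le_exp hh0 K (hkh hk)
        have h2 : 0 ≤ (1 + h * (K : ℝ)) := by positivity
        rw [mul_comm 2 k, pow_mul]
        have h3 : k * (h * L * M) ≤ t * L * M := by
          calc k * (h * L * M) = (k * h) * (L * M) := by ring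
            _ ≤ t * (L * M) := by
              have := hkh hk
              gcongr
            _ = _ := by ring
        rw [hΛ']
        gcongr
    have hwφ : ∀ k, k ≤ N → ∀ x, |v (φ (k * h) x) - w k x| ≤ M * (D * h) := by
      intro k hk x
      exact (hv.abs_sub_le _ _).trans
        (by gcongr; exact hφ.norm_sub_eulerStep_iterate_le hK hC hh0 (hkh hk) x)
    -- one Euler step against `μ`
    have hstepμ : ∀ k, k < N → |∫ x, w (k + 1) x ∂μ - ∫ x, w k x ∂μ -
        h * (∫ x, w k x ∂ν₁ - ∫ x, w k x ∂ν₀)| ≤ Λ' * (h * C) ^ 2 * μ.real univ := by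
      intro k hk
      have hwk := hwC k hk.le
      have hdc : Continuous fun x => fderiv ℝ (w k) x (F x) :=
        (hwk.contDiff.continuous_fderiv one_ne_zero).clm_apply hF.continuous
      have hdb : ∀ x, |fderiv ℝ (w k) x (F x)| ≤ M' * C := fun x =>
        (ContinuousLinearMap.le_opNorm _ _).trans
          (mul_le_mul (hwk.norm_fderiv_le x) (hC x) (norm_nonneg _) hwk.nonneg)
      have h1 : ∫ x, w k x ∂ν₁ - ∫ x, w k x ∂ν₀ = ∫ x, fderiv ℝ (w k) x (F x) ∂μ := by
        linarith [hdiv (w k) hwk.contDiff]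
      have i1 := integrable_of_continuous_of_bound μ (hwC (k + 1) hk).contDiff.continuous
        (hwB (k + 1))
      have i2 := integrable_of_continuous_of_bound μ hwk.contDiff.continuous (hwB k)
      have i3 := (integrable_of_continuous_of_bound μ hdc hdb).const_mul h
      rw [h1, ← integral_const_mul, ← integral_sub i1 i2, 
        ← integral_sub (f := fun x => w (k + 1) x - w k x) (i1.sub i2) i3]
      refine norm_integral_le_of_norm_le_const (μ := μ)
        (f := fun x => w (k + 1) x - w k x - h * fderiv ℝ (w k) x (F x)) (.of_forall fun x => ?_)
      have hx : w (k + 1) x = w k (x + h • F x) := by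
        simp only [hw, Function.iterate_succ, Function.comp_apply]; rfl
      have := hwk.abs_taylor_le hΛ'0 x (h • F x)
      rw [map_smul, smul_eq_mul, norm_smul, Real.norm_of_nonneg hh0] at this
      simp only [hx]
      refine this.trans ?_
      have := hC x
      gcongr
    -- the corresponding piece of the time integral
    have hstepν : ∀ k, k < N → |(∫ s in (k * h)..((k + 1 : ℕ) * h), Ψ s) -
        h * (∫ x, w k x ∂ν₁ - ∫ x, w k x ∂ν₀)| ≤
        h ^ 2 * (M * (C + D) * (ν₁.real univ + ν₀.real univ)) := by
      intro k hk
      have hle : k * h ≤ (k + 1 : ℕ) * h := by push_cast; linarith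
      have hlen : ((k + 1 : ℕ) : ℝ) * h - k * h = h := by push_cast; ring
      have hconst : h * (∫ x, w k x ∂ν₁ - ∫ x, w k x ∂ν₀) =
          ∫ _ in (k * h)..((k + 1 : ℕ) * h), (∫ x, w k x ∂ν₁ - ∫ x, w k x ∂ν₀) := by
        rw [intervalIntegral.integral_const, hlen, smul_eq_mul]
      rw [hconst, ← intervalIntegral.integral_sub (hΨc.intervalIntegrable _ _)
        intervalIntegrable_const]
      have hb : ∀ s ∈ uIoc (k * h) ((k + 1 : ℕ) * h),
          ‖Ψ s - (∫ x, w k x ∂ν₁ - ∫ x, w k x ∂ν₀)‖ ≤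
            h * (M * (C + D) * (ν₁.real univ + ν₀.real univ)) := by
        intro s hs
        rw [uIoc_of_le hle] at hs
        have hpt : ∀ x, |v (φ s x) - w k x| ≤ M * (C + D) * h := by
          intro x
          have h1 := hlipv s (k * h) x
          have h2 := hwφ k hk.le x
          have h3 : |s - k * h| ≤ h := by
            rw [abs_of_nonneg (by linarith [hs.1])]; linarith [hs.2, hlen]
          calc |v (φ s x) - w k x| ≤ |v (φ s x) - v (φ (k * h) x)| + |v (φ (k * h) x) - w k x| :=
                abs_sub_le _ _ _
            _ ≤ M * (C * h) + M * (D * h) := add_le_add (h1.trans (by gcongr)) h2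
            _ = _ := by ring
        have a1 := abs_integral_sub_integral_le ν₁ (hcv s) (hwC k hk.le).contDiff.continuous
          (fun x => hB _) (hwB k) hpt
        have a0 := abs_integral_sub_integral_le ν₀ (hcv s) (hwC k hk.le).contDiff.continuous
          (fun x => hB _) (hwB k) hpt
        rw [Real.norm_eq_abs, hΨ]
        rw [abs_le] at a1 a0 ⊢
        constructor <;> linarith only [a1.1, a1.2, a0.1, a0.2]
      have := intervalIntegral.norm_integral_le_of_norm_le_const hb
      rw [hlen, abs_of_nonneg hh0] at this
      refine this.trans_eq (by ring)
    have hacc : ∀ k, k ≤ N → |∫ x, w k x ∂μ - ∫ x, v x ∂μ - ∫ s in 0..(k * h), Ψ s| ≤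
        k * (h ^ 2 * G) := by
      intro k
      induction k with
      | zero => simp [hw]
      | succ k ih =>
        intro hk
        have ih := ih (by omega)
        have a := hstepμ k hk
        have b := hstepν k hk
        have hadd := intervalIntegral.integral_add_adjacent_intervals
          (hΨc.intervalIntegrable (μ := volume) 0 (k * h))
          (hΨc.intervalIntegrable (k * h) ((k + 1 : ℕ) * h))
        have hsum : Λ' * (h * C) ^ 2 * μ.real univ +
            h ^ 2 * (M * (C + D) * (ν₁.real univ + ν₀.real univ)) = h ^ 2 * G := by
          rw [hG]; ring
        have hsucc : ((k + 1 : ℕ) : ℝ) * (h ^ 2 * G) = k * (h ^ 2 * G) + h ^ 2 * G := by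
          push_cast; ring
        rw [← hadd, hsucc, ← hsum]
        rw [abs_le] at ih a b ⊢
        constructor <;> linarith only [ih.1, ih.2, a.1, a.2, b.1, b.2]
    have hfin := hacc N le_rfl
    have hlast := abs_integral_sub_integral_le μ (hcv t) (hwC N le_rfl).contDiff.continuous
      (fun x => hB _) (hwB N) (c := M * (D * h)) (by simpa only [hNh] using hwφ N le_rfl)
    rw [hNh] at hfin
    have e1 : (t ^ 2 * G + M * D * t * μ.real univ) / N =
        N * (h ^ 2 * G) + M * (D * h) * μ.real univ := by
      rw [hh]; field_simp
    rw [e1]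
    rw [abs_le] at hfin hlast ⊢
    constructor <;> linarith only [hfin.1, hfin.2, hlast.1, hlast.2]
  have hzero : |∫ x, v (φ t x) ∂μ - ∫ x, v x ∂μ - ∫ s in 0..t, Ψ s| ≤ 0 :=
    ge_of_tendsto (tendsto_const_div_atTop_nhds_zero_nat _)
      ((Filter.eventually_gt_atTop 0).mono hN)
  exact sub_eq_zero.1 (abs_nonpos_iff.1 hzero)

end Transport

section TransportMeasure

variable {E : Type*} [NormedAddCommGroup E] [InnerProductSpace ℝ E]

theorem hasC11Bound_sin_inner (ξ : E) (c : ℝ) :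
    HasC11Bound (fun x : E => Real.sin (inner ℝ x ξ + c)) ‖ξ‖ (‖ξ‖ ^ 2) := by
  have hd : ∀ x : E, HasFDerivAt (fun x : E => Real.sin (inner ℝ x ξ + c))
      (Real.cos (inner ℝ x ξ + c) • innerSL ℝ ξ) x := by
    intro x
    have h1 : HasFDerivAt (fun x : E => inner ℝ x ξ + c) (innerSL ℝ ξ) x := by
      have := ((innerSL ℝ ξ).hasFDerivAt (x := x)).add_const c
      simpa [real_inner_comm] using! this
    exact (Real.hasDerivAt_sin _).comp_hasFDerivAt x h1
  refine ⟨?_, fun x => ?_, fun x y => ?_⟩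
  · exact Real.contDiff_sin.comp ((contDiff_id.inner ℝ contDiff_const).add contDiff_const)
  · rw [(hd x).fderiv, norm_smul, innerSL_apply_norm]
    exact mul_le_of_le_one_left (norm_nonneg _) (Real.abs_cos_le_one _)
  · rw [(hd x).fderiv, (hd y).fderiv, ← sub_smul, norm_smul, innerSL_apply_norm]
    have hcos : ‖Real.cos (inner ℝ x ξ + c) - Real.cos (inner ℝ y ξ + c)‖ ≤
        ‖(inner ℝ x ξ + c) - (inner ℝ y ξ + c)‖ := by
      have := convex_univ.norm_image_sub_le_of_norm_hasDerivWithin_le (C := 1)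
        (fun r _ => (Real.hasDerivAt_cos r).hasDerivWithinAt)
        (fun r _ => by rw [norm_neg]; exact Real.abs_sin_le_one r)
        (mem_univ (inner ℝ y ξ + c)) (mem_univ (inner ℝ x ξ + c))
      simpa using this
    have hin : ‖(inner ℝ x ξ + c) - (inner ℝ y ξ + c)‖ ≤ ‖x - y‖ * ‖ξ‖ := by
      rw [add_sub_add_right_eq_sub, ← inner_sub_left]
      exact norm_inner_le_norm _ _
    calc _ ≤ (‖x - y‖ * ‖ξ‖) * ‖ξ‖ := by gcongr; exact hcos.trans hin
      _ = _ := by ring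

variable [MeasurableSpace E] [BorelSpace E]

/-- Finite measures are determined by their integrals against phase-shifted sine waves, because
these are the real and imaginary parts of the characteristic function. -/
theorem measure_ext_of_integral_sin_inner [CompleteSpace E] [SecondCountableTopology E]
    {μ ν : Measure E} [IsFiniteMeasure μ] [IsFiniteMeasure ν]
    (h : ∀ (ξ : E) (c : ℝ),
      ∫ x, Real.sin (inner ℝ x ξ + c) ∂μ = ∫ x, Real.sin (inner ℝ x ξ + c) ∂ν) : μ = ν := by
  refine Measure.ext_of_charFun (funext fun ξ => ?_)
  have key : ∀ ρ : Measure E, IsFiniteMeasure ρ → charFun ρ ξ =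
      ((∫ x, Real.sin (inner ℝ x ξ + Real.pi / 2) ∂ρ : ℝ) : ℂ) +
        ((∫ x, Real.sin (inner ℝ x ξ + 0) ∂ρ : ℝ) : ℂ) * Complex.I := by
    intro ρ _
    have hi : ∀ c, Integrable (fun x : E => ((Real.sin (inner ℝ x ξ + c) : ℝ) : ℂ)) ρ := fun c =>
      (integrable_of_continuous_of_bound ρ (hasC11Bound_sin_inner ξ c).contDiff.continuous
        (fun x => Real.abs_sin_le_one _)).ofReal
    rw [charFun_apply, ← integral_complex_ofReal, ← integral_complex_ofReal,
      ← integral_mul_const, ← integral_add (hi _) ((hi _).mul_const _)]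
    refine integral_congr_ae (.of_forall fun x => ?_)
    simp only [Real.sin_add_pi_div_two, add_zero]
    rw [Complex.exp_mul_I]
    push_cast
    rfl
  rw [key μ inferInstance, key ν inferInstance, h, h]

/-- The measure `∫₀ᵗ (φ s)_* ν ds`. -/
noncomputable def flowAverage (φ : ℝ → E → E) (ν : Measure E) (t : ℝ) : Measure E :=
  (((volume : Measure ℝ).restrict (Ioc 0 t)).prod ν).map fun p => φ p.1 p.2

variable [SecondCountableTopology E]
  {F : E → E} {φ : ℝ → E → E} {K C : ℝ≥0} {L : ℝ}
  {μ ν₀ ν₁ : Measure E} [IsFiniteMeasure μ] [IsFiniteMeasure ν₀] [IsFiniteMeasure ν₁]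

theorem isFiniteMeasure_flowAverage {E : Type*} [MeasurableSpace E] (φ : ℝ → E → E)
    (ν : Measure E) [IsFiniteMeasure ν] (t : ℝ) :
    IsFiniteMeasure (flowAverage φ ν t) := by
  unfold flowAverage; infer_instance

theorem IsGlobalFlow.integral_flowAverage (hφ : IsGlobalFlow F φ) (hK : LipschitzWith K F)
    (hC : ∀ x, ‖F x‖ ≤ C) (ν : Measure E) [IsFiniteMeasure ν] {v : E → ℝ} {B : ℝ}
    (hv : Continuous v) (hB : ∀ x, |v x| ≤ B) {t : ℝ} (ht : 0 ≤ t) :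
    ∫ x, v x ∂(flowAverage φ ν t) = ∫ s in 0..t, ∫ x, v (φ s x) ∂ν := by
  have hc := hφ.continuous_uncurry hK hC
  rw [flowAverage, integral_map hc.measurable.aemeasurable hv.aestronglyMeasurable,
    integral_prod (fun p : ℝ × E => v (φ p.1 p.2))
      (integrable_of_continuous_of_bound _ (hv.comp hc) fun p => hB _),
    intervalIntegral.integral_of_le ht]

theorem IsGlobalFlow.flowAverage_apply (hφ : IsGlobalFlow F φ) (hK : LipschitzWith K F)
    (hC : ∀ x, ‖F x‖ ≤ C) (ν : Measure E) [IsFiniteMeasure ν] (t : ℝ) {S : Set E}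
    (hS : MeasurableSet S) :
    flowAverage φ ν t S = ∫⁻ s in Ioc 0 t, ν (φ s ⁻¹' S) := by
  have hm := (hφ.continuous_uncurry hK hC).measurable
  rw [flowAverage, Measure.map_apply hm hS, Measure.prod_apply (hm hS)]
  rfl

/-- Mass balance along the flow: after time `t` the measure `μ` has lost what `ν₀` injects and
gained what `ν₁` removes, each transported for the remaining time. -/
theorem IsGlobalFlow.map_add_flowAverage [CompleteSpace E] (hφ : IsGlobalFlow F φ)
    (hF : ContDiff ℝ 1 F) (hK : LipschitzWith K F) (hL : 0 ≤ L)
    (hDF : ∀ x y, ‖fderiv ℝ F x - fderiv ℝ F y‖ ≤ L * ‖x - y‖) (hC : ∀ x, ‖F x‖ ≤ C)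
    (hdiv : ∀ w : E → ℝ, ContDiff ℝ 1 w →
      -(∫ x, fderiv ℝ w x (F x) ∂μ) + ∫ x, w x ∂ν₁ = ∫ x, w x ∂ν₀)
    {t : ℝ} (ht : 0 ≤ t) :
    μ.map (φ t) + flowAverage φ ν₀ t = μ + flowAverage φ ν₁ t := by
  have := isFiniteMeasure_flowAverage φ ν₀ t
  have := isFiniteMeasure_flowAverage φ ν₁ t
  refine measure_ext_of_integral_sin_inner fun ξ c => ?_
  have hv := hasC11Bound_sin_inner ξ c
  have hB : ∀ x : E, |Real.sin (inner ℝ x ξ + c)| ≤ 1 := fun x => Real.abs_sin_le_one _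
  have hi : ∀ (ρ : Measure E) [IsFiniteMeasure ρ],
      Integrable (fun x : E => Real.sin (inner ℝ x ξ + c)) ρ := fun ρ _ =>
    integrable_of_continuous_of_bound ρ hv.contDiff.continuous hB
  have hmain := hφ.integral_comp_sub_integral hF hK hL hDF hC hdiv (sq_nonneg _) hv hB ht
  have hii : ∀ (ν : Measure E) [IsFiniteMeasure ν], IntervalIntegrable
      (fun s => ∫ x, Real.sin (inner ℝ (φ s x) ξ + c) ∂ν) volume 0 t := by
    intro ν _
    refine Continuous.intervalIntegrable ?_ _ _
    exact continuous_of_dominated (bound := fun _ => 1)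
      (fun s => (hv.contDiff.continuous.comp (hφ.continuous_space hK s)).aestronglyMeasurable)
      (fun s => .of_forall fun x => hB _) (integrable_const _)
      (.of_forall fun x => hv.contDiff.continuous.comp (hφ.continuous_time x))
  rw [intervalIntegral.integral_sub (hii ν₁) (hii ν₀)] at hmain
  rw [integral_add_measure (hi _) (hi _), integral_add_measure (hi _) (hi _),
    hφ.integral_flowAverage hK hC ν₀ hv.contDiff.continuous hB ht,
    hφ.integral_flowAverage hK hC ν₁ hv.contDiff.continuous hB ht,
    integral_map (hφ.continuous_space hK t).measurable.aemeasurable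
      hv.contDiff.continuous.aestronglyMeasurable]
  linarith

/-- If a finite measure `μ` satisfies `div(F μ) + ν₁ = ν₀`, the source `ν₀` does not charge any
positively invariant set `A` which the sink `ν₁` does not charge and each point of which was in `A`
a short time before.

The mass balance is evaluated on `φ t A ⊆ A`. The points whose trajectory reaches `φ t A` before
time `t` lie in `A`, so `ν₁` contributes nothing. The transported `μ` has mass `μ A` there, and `μ`
itself at most as much; this leaves no room for `ν₀`. -/
theorem IsGlobalFlow.source_eq_zero_of_forwardInvariant [CompleteSpace E]
    (hφ : IsGlobalFlow F φ)
    (hF : ContDiff ℝ 1 F) (hK : LipschitzWith K F) (hL : 0 ≤ L)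
    (hDF : ∀ x y, ‖fderiv ℝ F x - fderiv ℝ F y‖ ≤ L * ‖x - y‖) (hC : ∀ x, ‖F x‖ ≤ C)
    (hdiv : ∀ w : E → ℝ, ContDiff ℝ 1 w →
      -(∫ x, fderiv ℝ w x (F x) ∂μ) + ∫ x, w x ∂ν₁ = ∫ x, w x ∂ν₀)
    {A : Set E} (hA : MeasurableSet A) (hinv : ∀ s, 0 ≤ s → ∀ x ∈ A, φ s x ∈ A)
    (hback : ∀ x ∈ A, ∃ t, 0 < t ∧ φ (-t) x ∈ A) (hν₁ : ν₁ A = 0) : ν₀ A = 0 := by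
  have hsub : ∀ t, 0 ≤ t → φ (-t) ⁻¹' A ⊆ A := fun t ht x hx => by
    have := hinv t ht _ hx
    rwa [hφ.apply_neg_apply hK] at this
  have hzero : ∀ t, 0 < t → ν₀ (φ (-t) ⁻¹' A) = 0 := by
    intro t ht
    have hmeas : MeasurableSet (φ (-t) ⁻¹' A) := (hφ.continuous_space hK (-t)).measurable hA
    have hbal := congrArg (fun ρ : Measure E => ρ (φ (-t) ⁻¹' A))
      (hφ.map_add_flowAverage hF hK hL hDF hC hdiv ht.le)
    simp only [Measure.add_apply] at hbal
    have hpre : φ t ⁻¹' (φ (-t) ⁻¹' A) = A := by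
      ext x; simp only [mem_preimage, hφ.neg_apply_apply hK]
    rw [Measure.map_apply (hφ.continuous_space hK t).measurable hmeas, hpre,
      hφ.flowAverage_apply hK hC ν₀ t hmeas, hφ.flowAverage_apply hK hC ν₁ t hmeas] at hbal
    have h1 : ∫⁻ s in Ioc 0 t, ν₁ (φ s ⁻¹' (φ (-t) ⁻¹' A)) = 0 := by
      rw [setLIntegral_congr_fun measurableSet_Ioc (g := fun _ => 0), lintegral_zero]
      intro s hs
      refine measure_mono_null (fun x hx => ?_) hν₁
      have hx' : φ (-(t - s)) x ∈ A := by
        have : φ (-t) (φ s x) ∈ A := hx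
        rwa [← hφ.add hK, show -t + s = -(t - s) by ring] at this
      exact hsub (t - s) (by linarith [hs.2]) hx'
    have h0 : ν₀ (φ (-t) ⁻¹' A) * ENNReal.ofReal t ≤
        ∫⁻ s in Ioc 0 t, ν₀ (φ s ⁻¹' (φ (-t) ⁻¹' A)) := by
      have : ν₀ (φ (-t) ⁻¹' A) * ENNReal.ofReal t = ∫⁻ _ in Ioc 0 t, ν₀ (φ (-t) ⁻¹' A) := by
        rw [setLIntegral_const, Real.volume_Ioc, sub_zero]
      rw [this]
      refine setLIntegral_mono_ae' measurableSet_Ioc (.of_forall fun s hs => measure_mono ?_)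
      intro x hx
      change φ (-t) (φ s x) ∈ A
      rw [← hφ.add hK, add_comm, hφ.add hK]
      exact hinv s hs.1.le _ hx
    rw [h1, add_zero] at hbal
    have hle : μ A + ν₀ (φ (-t) ⁻¹' A) * ENNReal.ofReal t ≤ μ A + 0 := by
      rw [add_zero]
      calc _ ≤ _ := add_le_add_right h0 _
        _ = _ := hbal
        _ ≤ _ := measure_mono (hsub t ht.le)
    have hle' := (ENNReal.add_le_add_iff_left (measure_ne_top μ A)).1 hle
    have := nonpos_iff_eq_zero.1 hle'
    simpa [not_le.2 ht] using this
  refine measure_mono_null (t := ⋃ k : ℕ, φ (-(1 / ((k : ℝ) + 1))) ⁻¹' A) (fun x hx => ?_)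
    (measure_iUnion_null fun k => hzero _ (by positivity))
  obtain ⟨t, ht, hxt⟩ := hback x hx
  obtain ⟨k, hk⟩ := exists_nat_one_div_lt ht
  refine mem_iUnion.2 ⟨k, ?_⟩
  have := hinv (t - 1 / ((k : ℝ) + 1)) (by linarith) _ hxt
  rw [← hφ.add hK] at this
  rw [mem_preimage]
  convert this using 2
  ring

end TransportMeasure

/-! ### Zero sets of polynomials -/

/-- The zero set of a nonzero polynomial on `ℝⁿ` is Lebesgue-null: for almost every value of the
last variables the polynomial in the first one is nonzero, hence has finitely many roots. -/
theorem volume_zeros_mvPolynomial_eq_zero {n : ℕ} {p : MvPolynomial (Fin n) ℝ} (hp : p ≠ 0) :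
    volume {x : Fin n → ℝ | MvPolynomial.eval x p = 0} = 0 := by
  induction n with
  | zero =>
    convert measure_empty (μ := (volume : Measure (Fin 0 → ℝ)))
    refine eq_empty_of_forall_notMem fun x hx => hp ?_
    rw [MvPolynomial.eq_C_of_isEmpty p] at hx ⊢
    rw [mem_ofPred_eq, MvPolynomial.eval_C] at hx
    rw [hx, map_zero]
  | succ n ih =>
    set q := MvPolynomial.finSuccEquiv ℝ n p with hq
    have hq0 : q ≠ 0 := by simpa [hq] using hp
    have hlead : q.leadingCoeff ≠ 0 := Polynomial.leadingCoeff_ne_zero.2 hq0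
    have hmeas : MeasurableSet {x : Fin (n + 1) → ℝ | MvPolynomial.eval x p = 0} :=
      (isClosed_singleton.preimage (MvPolynomial.continuous_eval p)).measurableSet
    have hmp := (volume_preserving_piFinSuccAbove (fun _ : Fin (n + 1) => ℝ) 0).symm
    rw [← hmp.measure_preimage hmeas.nullMeasurableSet, Measure.volume_eq_prod,
      ← Measure.prod_swap, Measure.map_apply measurable_swap (hmp.measurable hmeas)]
    refine Measure.measure_prod_null_of_ae_null (measurable_swap (hmp.measurable hmeas)) ?_
    have hae : ∀ᵐ y : Fin n → ℝ, MvPolynomial.eval y q.leadingCoeff ≠ 0 := by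
      rw [ae_iff]
      simpa using ih hlead
    filter_upwards [hae] with y hy
    have hqy : q.map (MvPolynomial.eval y) ≠ 0 := fun h0 => hy (by
      have := congrArg (fun r : Polynomial ℝ => r.coeff q.natDegree) h0
      simpa [Polynomial.coeff_map] using this)
    refine (Set.Finite.subset (Polynomial.finite_setOfPred_isRoot hqy) fun r hr => ?_).measure_zero
      volume
    have hr' : MvPolynomial.eval (Fin.cons r y : Fin (n + 1) → ℝ) p = 0 := by
      rw [← Fin.insertNth_zero']
      exact hr
    rwa [MvPolynomial.eval_eq_eval_mv_eval'] at hr'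

theorem boundary_semialgebraicSet_subset {n m : ℕ} (g : Fin m → MvPolynomial (Fin n) ℝ) :
    boundary (semialgebraicSet g) ⊆
      ⋃ i ∈ {i | g i ≠ 0}, {x : State n | MvPolynomial.eval (fun j => x j) (g i) = 0} := by
  intro x hx
  by_contra hcon
  simp only [mem_iUnion, not_exists, mem_ofPred_eq] at hcon
  refine hx.2 (mem_interior_iff_mem_nhds.2 ?_)
  have : ∀ i, ∀ᶠ y : State n in 𝓝 x, 0 ≤ MvPolynomial.eval (fun j => y j) (g i) := by
    intro i
    by_cases hi : g i = 0
    · simp [hi]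
    · have hpos : 0 < MvPolynomial.eval (fun j => x j) (g i) := lt_of_le_of_ne (hx.1 i)
        (Ne.symm (hcon i hi))
      have hc : Continuous fun y : State n => MvPolynomial.eval (fun j => y j) (g i) :=
        (MvPolynomial.continuous_eval (g i)).comp (PiLp.continuous_ofLp 2 _)
      exact (hc.continuousAt.eventually (lt_mem_nhds hpos)).mono fun y hy => hy.le
  exact Filter.eventually_all.2 this

theorem volume_boundary_semialgebraicSet {n m : ℕ} (g : Fin m → MvPolynomial (Fin n) ℝ) :
    volume (boundary (semialgebraicSet g)) = 0 := by
  refine measure_mono_null (boundary_semialgebraicSet_subset g)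
    ((measure_biUnion_null_iff (to_countable _)).2 fun i hi => ?_)
  have hmp := EuclideanSpace.volume_preserving_symm_measurableEquiv_toLp (Fin n)
  exact hmp.quasiMeasurePreserving.preimage_null (volume_zeros_mvPolynomial_eq_zero hi)

/-! ### Cutting off the vector field -/

theorem contDiff_vectorField {n : ℕ} (f : Fin n → MvPolynomial (Fin n) ℝ) {k : WithTop ℕ∞} :
    ContDiff ℝ k (vectorField f) := by
  rw [contDiff_euclidean]
  intro i
  exact (AnalyticOnNhd.eval_continuousLinearMap'
    (𝕜 := ℝ) (E := State n) (B := ℝ) (fun j => EuclideanSpace.proj j) (f i)).contDiff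

/-- A smooth vector field agrees on a compact set with a smooth compactly supported one, which is
bounded and Lipschitz together with its derivative. -/
theorem exists_cutoff {n : ℕ} {F : State n → State n} (hF : ContDiff ℝ 2 F) {X : Set (State n)}
    (hX : IsCompact X) :
    ∃ (G : State n → State n) (K C L : ℝ≥0), ContDiff ℝ 1 G ∧ LipschitzWith K G ∧
      (∀ x, ‖G x‖ ≤ C) ∧ (∀ x y, ‖fderiv ℝ G x - fderiv ℝ G y‖ ≤ L * ‖x - y‖) ∧ EqOn G F X := by
  obtain ⟨R, hR⟩ := hX.isBounded.subset_closedBall (0 : State n)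
  let χ : ContDiffBump (0 : State n) :=
    ⟨|R| + 1, |R| + 2, by positivity, by linarith⟩
  set G : State n → State n := fun x => χ x • F x with hG
  have hGc : ContDiff ℝ 2 G := χ.contDiff.smul hF
  have hGs : HasCompactSupport G := χ.hasCompactSupport.smul_right
  obtain ⟨K, hK⟩ := hGc.lipschitzWith_of_hasCompactSupport hGs two_ne_zero
  obtain ⟨C, hC⟩ := hGs.exists_bound_of_continuous hGc.continuous
  obtain ⟨L, hL⟩ := (hGc.fderiv_right (m := 1) le_rfl).lipschitzWith_of_hasCompactSupport
    (hGs.fderiv ℝ) one_ne_zero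
  refine ⟨G, K, C.toNNReal, L, hGc.of_le (by norm_num), hK,
    fun x => (hC x).trans (Real.le_coe_toNNReal C), fun x y => hL.norm_sub_le x y, fun x hx => ?_⟩
  have hx1 : χ x = 1 := χ.one_of_mem_closedBall
    (Metric.closedBall_subset_closedBall (by change R ≤ |R| + 1; linarith [le_abs_self R]) (hR hx))
  simp [hG, hx1]

/-! ### Exit times of a flow -/

theorem exists_first_exit {Y : Type*} [TopologicalSpace Y] {U : Set Y} (hU : IsOpen U) {γ : ℝ → Y}
    {b t : ℝ} (hγ : ContinuousOn γ (Icc 0 b)) (ht : t ∈ Icc 0 b) (htU : γ t ∉ U) :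
    ∃ s ∈ Icc 0 t, γ s ∉ U ∧ ∀ r ∈ Ico 0 s, γ r ∈ U := by
  have hcl : IsClosed (Icc 0 t ∩ γ ⁻¹' Uᶜ) :=
    (hγ.mono (Icc_subset_Icc_right ht.2)).preimage_isClosed_of_isClosed isClosed_Icc
      hU.isClosed_compl
  have hcpt : IsCompact (Icc 0 t ∩ γ ⁻¹' Uᶜ) :=
    isCompact_Icc.of_isClosed_subset hcl inter_subset_left
  obtain ⟨s, hs, hmin⟩ := hcpt.exists_isLeast ⟨t, ⟨ht.1, le_rfl⟩, htU⟩
  refine ⟨s, hs.1, hs.2, fun r hr => ?_⟩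
  by_contra hrU
  exact absurd (hmin ⟨⟨hr.1, hr.2.le.trans hs.1.2⟩, hrU⟩) (not_le.2 hr.2)

/-- A curve that lies in `interior X` up to the time `s` is still in the closed set `X` at `s`. -/
theorem mem_of_forall_mem_interior {Y : Type*} [TopologicalSpace Y] {X : Set Y} (hX : IsClosed X)
    {γ : ℝ → Y} {s : ℝ} (hγ : ContinuousOn γ (Icc 0 s)) (h0 : γ 0 ∈ X)
    (h : ∀ r ∈ Ico 0 s, γ r ∈ interior X) : ∀ r ∈ Icc 0 s, γ r ∈ X := by
  intro r hr
  rcases hr.1.eq_or_lt with rfl | hr0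
  · exact h0
  have hmem : r ∈ closure (Ico 0 r) := by
    rw [closure_Ico hr0.ne]
    exact right_mem_Icc.2 hr0.le
  have hc : ContinuousWithinAt γ (Ico 0 r) r :=
    (hγ r hr).mono fun u hu => ⟨hu.1, hu.2.le.trans hr.2⟩
  exact hX.closure_subset (hc.mem_closure hmem fun u hu =>
    interior_subset (h u ⟨hu.1, hu.2.trans_le hr.2⟩))

/-- The first time at which the trajectory `s ↦ φ s x`, `s ≥ 0`, is outside `U`. -/
noncomputable def flowExitTime {E : Type*} (φ : ℝ → E → E) (U : Set E) (x : E) : ℝ≥0∞ :=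
  sInf {t : ℝ≥0∞ | ∃ s : ℝ≥0, t = s ∧ φ s x ∉ U}

section FlowExit

variable {E : Type*} [NormedAddCommGroup E] [NormedSpace ℝ E] {F : E → E} {φ : ℝ → E → E}
  {K C : ℝ≥0} {U : Set E}

theorem IsGlobalFlow.lt_flowExitTime_iff (hφ : IsGlobalFlow F φ) (hU : IsOpen U) (x : E)
    (t : ℝ≥0) : (t : ℝ≥0∞) < flowExitTime φ U x ↔ ∀ s ∈ Icc 0 (t : ℝ), φ s x ∈ U := by
  constructor
  · intro h s hs
    by_contra hsU
    lift s to ℝ≥0 using hs.1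
    have hle : flowExitTime φ U x ≤ s := sInf_le ⟨s, rfl, hsU⟩
    exact absurd h (not_lt.2 (hle.trans (by exact_mod_cast hs.2)))
  · intro h
    by_cases hex : ∃ s : ℝ≥0, φ s x ∉ U
    · -- the infimum is attained at the first exit
      obtain ⟨s, hs⟩ := hex
      obtain ⟨r, hr, hrU, hmin⟩ := exists_first_exit hU
        (hφ.continuous_time x).continuousOn (right_mem_Icc.2 s.coe_nonneg) hs
      lift r to ℝ≥0 using hr.1
      have htr : t < r := by
        by_contra! hle
        exact hrU (h r ⟨r.coe_nonneg, hle⟩)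
      refine lt_of_lt_of_le (ENNReal.coe_lt_coe.2 htr) (le_sInf ?_)
      rintro _ ⟨u, rfl, huU⟩
      by_contra! hlt
      exact huU (hmin u ⟨u.coe_nonneg, by exact_mod_cast hlt⟩)
    · have : {t : ℝ≥0∞ | ∃ s : ℝ≥0, t = s ∧ φ s x ∉ U} = ∅ :=
        eq_empty_of_forall_notMem fun _ ⟨s, _, hs⟩ => hex ⟨s, hs⟩
      simp [flowExitTime, this]

theorem IsGlobalFlow.flowExitTime_ne_top_iff (hφ : IsGlobalFlow F φ) (hU : IsOpen U) (x : E) :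
    flowExitTime φ U x ≠ ⊤ ↔ ∃ s : ℝ≥0, φ s x ∉ U := by
  constructor
  · intro h
    by_contra! hcon
    have hlt := (hφ.lt_flowExitTime_iff hU x (flowExitTime φ U x).toNNReal).2
      fun s hs => hcon ⟨s, hs.1⟩
    rw [ENNReal.coe_toNNReal h] at hlt
    exact lt_irrefl _ hlt
  · rintro ⟨s, hs⟩
    exact ne_top_of_le_ne_top ENNReal.coe_ne_top (sInf_le ⟨s, rfl, hs⟩)

theorem IsGlobalFlow.mem_of_lt_flowExitTime (hφ : IsGlobalFlow F φ) (hU : IsOpen U) {x : E}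
    (h : flowExitTime φ U x ≠ ⊤) : ∀ s ∈ Ico 0 (flowExitTime φ U x).toReal, φ s x ∈ U := by
  intro s hs
  lift s to ℝ≥0 using hs.1
  refine (hφ.lt_flowExitTime_iff hU x s).1 ?_ s (right_mem_Icc.2 s.coe_nonneg)
  rw [← ENNReal.coe_toNNReal h]
  exact_mod_cast hs.2

theorem IsGlobalFlow.apply_flowExitTime_notMem (hφ : IsGlobalFlow F φ) (hU : IsOpen U) {x : E}
    (h : flowExitTime φ U x ≠ ⊤) : φ (flowExitTime φ U x).toReal x ∉ U := by
  intro hmem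
  have hlt := (hφ.lt_flowExitTime_iff hU x (flowExitTime φ U x).toNNReal).2 fun s hs => by
    rcases hs.2.lt_or_eq with h' | h'
    · exact hφ.mem_of_lt_flowExitTime hU h s ⟨hs.1, h'⟩
    · rw [h']; exact hmem
  rw [ENNReal.coe_toNNReal h] at hlt
  exact lt_irrefl _ hlt

theorem IsGlobalFlow.isOpen_setOf_forall_mem (hφ : IsGlobalFlow F φ) (hK : LipschitzWith K F)
    (hC : ∀ x, ‖F x‖ ≤ C) (hU : IsOpen U) (t : ℝ) :
    IsOpen {x | ∀ s ∈ Icc 0 t, φ s x ∈ U} := by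
  rw [isOpen_iff_eventually]
  intro x hx
  refine isCompact_Icc.eventually_forall_of_forall_eventually fun s hs => ?_
  have hc : Continuous fun p : E × ℝ => φ p.2 p.1 :=
    (hφ.continuous_uncurry hK hC).comp continuous_swap
  exact hc.continuousAt.eventually (hU.mem_nhds (hx s hs))

theorem IsGlobalFlow.measurable_flowExitTime [MeasurableSpace E] [BorelSpace E]
    (hφ : IsGlobalFlow F φ) (hK : LipschitzWith K F) (hC : ∀ x, ‖F x‖ ≤ C) (hU : IsOpen U) :
    Measurable (flowExitTime φ U) := by
  refine measurable_of_Ioi fun a => ?_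
  induction a with
  | top => simp
  | coe t =>
    have : flowExitTime φ U ⁻¹' Ioi (t : ℝ≥0∞) = {x | ∀ s ∈ Icc 0 (t : ℝ), φ s x ∈ U} := by
      ext x; exact hφ.lt_flowExitTime_iff hU x t
    rw [this]
    exact (hφ.isOpen_setOf_forall_mem hK hC hU t).measurableSet

end FlowExit

section LocalSolutions

variable {n : ℕ} {F G : State n → State n} {φ : ℝ → State n → State n} {K : ℝ≥0}
  {X : Set (State n)} {x : State n}

/-- If `G` agrees with `F` on `X`, an orbit of the flow of `G` that stays in `X` is a solution of
`ẋ = F x`. -/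
theorem IsGlobalFlow.solutionAt (hφ : IsGlobalFlow G φ) (hGF : EqOn G F X) {s : ℝ≥0}
    (h : ∀ r ∈ Icc 0 (s : ℝ), φ r x ∈ X) : SolutionAt F x s (φ s x) := by
  refine ⟨fun t => φ t x, hφ.zero x, fun t ht => ?_, rfl⟩
  have := (hφ.isIntegralCurve x t).hasDerivWithinAt (s := Icc 0 (s : ℝ))
  simpa only [hGF (h t ht)] using this

/-- If `G` agrees with `F` on `X`, a solution of `ẋ = F x` that stays in `X` follows the flow
of `G`. -/
theorem IsGlobalFlow.eqOn_of_mem (hφ : IsGlobalFlow G φ) (hK : LipschitzWith K G)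
    (hGF : EqOn G F X) {γ : ℝ → State n} {b : ℝ} (hγ0 : γ 0 = x)
    (hγ : IsIntegralCurveOn γ (fun _ => F) (Icc 0 b)) (h : ∀ r ∈ Icc 0 b, γ r ∈ X) :
    ∀ r ∈ Icc 0 b, γ r = φ r x := by
  intro r hr
  have hγ' : IsIntegralCurveOn γ (fun _ => G) (Icc 0 b) := fun t ht => by
    have := hγ t ht
    simpa only [hGF (h t ht)] using this
  rw [← dist_le_zero]
  have := dist_integralCurveOn_le hK hγ' ((hφ.isIntegralCurve x).isIntegralCurveOn (Icc 0 b)) hr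
  simpa [hγ0, hφ.zero] using this

/-- A solution of `ẋ = F x` that starts in `interior X` and has left it follows the flow of `G`
up to its first exit. -/
theorem IsGlobalFlow.exists_exit_of_integralCurveOn (hφ : IsGlobalFlow G φ)
    (hK : LipschitzWith K G) (hGF : EqOn G F X) (hX : IsClosed X) (hx : x ∈ interior X)
    {γ : ℝ → State n} {b t : ℝ} (hγ0 : γ 0 = x)
    (hγ : IsIntegralCurveOn γ (fun _ => F) (Icc 0 b)) (ht : t ∈ Icc 0 b)
    (htX : γ t ∉ interior X) :
    ∃ s ∈ Icc 0 t, γ s = φ s x ∧ φ s x ∉ interior X := by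
  have hc : ContinuousOn γ (Icc 0 b) := fun r hr => (hγ r hr).continuousWithinAt
  obtain ⟨s, hs, hsX, hmin⟩ := exists_first_exit isOpen_interior hc ht htX
  have hsub : Icc 0 s ⊆ Icc 0 b := Icc_subset_Icc_right (hs.2.trans ht.2)
  have hmem := mem_of_forall_mem_interior hX (hc.mono hsub)
    (by rw [hγ0]; exact interior_subset hx) hmin
  have heq := hφ.eqOn_of_mem hK hGF hγ0 (hγ.mono hsub) hmem s (right_mem_Icc.2 hs.1)
  exact ⟨s, hs, heq, heq ▸ hsX⟩

theorem IsGlobalFlow.exitTime_eq (hφ : IsGlobalFlow G φ) (hK : LipschitzWith K G)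
    (hGF : EqOn G F X) (hX : IsClosed X) (hx : x ∈ interior X) :
    exitTime F X x = flowExitTime φ (interior X) x := by
  apply le_antisymm
  · refine le_sInf ?_
    rintro _ ⟨s, rfl, hs⟩
    have hc := (hφ.continuous_time x).continuousOn (s := Icc 0 (s : ℝ))
    obtain ⟨r, hr, hrX, hmin⟩ := exists_first_exit isOpen_interior hc
      (right_mem_Icc.2 s.coe_nonneg) hs
    lift r to ℝ≥0 using hr.1
    have hmem := mem_of_forall_mem_interior hX (hφ.continuous_time x).continuousOn
      (by rw [hφ.zero]; exact interior_subset hx) hmin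
    have hle : exitTime F X x ≤ r := sInf_le ⟨r, rfl, _, hrX, hφ.solutionAt hGF hmem⟩
    exact hle.trans (by exact_mod_cast hr.2)
  · refine le_sInf ?_
    rintro _ ⟨s, rfl, y, hy, γ, hγ0, hγ, rfl⟩
    obtain ⟨r, hr, -, hrX⟩ := hφ.exists_exit_of_integralCurveOn hK hGF hX hx hγ0 hγ
      (right_mem_Icc.2 s.coe_nonneg) hy
    lift r to ℝ≥0 using hr.1
    have hle : flowExitTime φ (interior X) x ≤ r := sInf_le ⟨r, rfl, hrX⟩
    exact hle.trans (by exact_mod_cast hr.2)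

theorem IsGlobalFlow.mem_mpiSet_iff (hφ : IsGlobalFlow G φ) (hK : LipschitzWith K G)
    (hGF : EqOn G F X) (hX : IsClosed X) :
    x ∈ mpiSet F X ↔ ∀ s, 0 ≤ s → φ s x ∈ interior X := by
  constructor
  · rintro ⟨hx, h⟩ s hs
    by_contra hsX
    obtain ⟨r, hr, hrX, hmin⟩ := exists_first_exit isOpen_interior
      (hφ.continuous_time x).continuousOn (right_mem_Icc.2 hs) hsX
    lift r to ℝ≥0 using hr.1
    obtain ⟨y, hy, γ, hγ0, hγ, rfl⟩ := h r le_top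
    -- the solution up to time `r` cannot have left `interior X` before the flow of `G` does
    by_cases hex : ∃ t ∈ Icc 0 (r : ℝ), γ t ∉ interior X
    · obtain ⟨t, ht, htX⟩ := hex
      obtain ⟨u, hu, heq, huX⟩ := hφ.exists_exit_of_integralCurveOn hK hGF hX hx hγ0 hγ ht htX
      have hur : u = r := by
        refine le_antisymm (hu.2.trans ht.2) ?_
        by_contra! hlt
        exact huX (hmin u ⟨hu.1, hlt⟩)
      rw [← heq, hur] at huX
      exact huX hy
    · push Not at hex
      have := hφ.eqOn_of_mem hK hGF hγ0 hγ (fun t ht => interior_subset (hex t ht)) r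
        (right_mem_Icc.2 r.coe_nonneg)
      rw [this] at hy
      exact hrX hy
  · intro h
    refine ⟨by simpa [hφ.zero] using h 0 le_rfl, fun s _ => ⟨φ s x, h s s.coe_nonneg, ?_⟩⟩
    exact hφ.solutionAt hGF fun r hr => interior_subset (h r hr.1)

theorem IsGlobalFlow.mem_mpiCompl_iff (hφ : IsGlobalFlow G φ) (hK : LipschitzWith K G)
    (hGF : EqOn G F X) (hX : IsClosed X) :
    x ∈ mpiCompl F X ↔ x ∈ interior X ∧ flowExitTime φ (interior X) x ≠ ⊤ := by
  refine and_congr_right fun _ => ?_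
  rw [hφ.flowExitTime_ne_top_iff isOpen_interior, hφ.mem_mpiSet_iff hK hGF hX]
  push Not
  exact ⟨fun ⟨s, hs, h⟩ => ⟨⟨s, hs⟩, h⟩, fun ⟨s, h⟩ => ⟨s, s.coe_nonneg, h⟩⟩

theorem IsGlobalFlow.measurableSet_mpiCompl {C : ℝ≥0} (hφ : IsGlobalFlow G φ)
    (hK : LipschitzWith K G) (hC : ∀ x, ‖G x‖ ≤ C) (hGF : EqOn G F X) (hX : IsClosed X) :
    MeasurableSet (mpiCompl F X) := by
  have : mpiCompl F X = interior X ∩ (flowExitTime φ (interior X) ⁻¹' {⊤})ᶜ := by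
    ext x; exact hφ.mem_mpiCompl_iff hK hGF hX
  rw [this]
  exact isOpen_interior.measurableSet.inter
    (hφ.measurable_flowExitTime hK hC isOpen_interior (measurableSet_singleton _)).compl

theorem IsGlobalFlow.measurableSet_mpiSet {C : ℝ≥0} (hφ : IsGlobalFlow G φ)
    (hK : LipschitzWith K G) (hC : ∀ x, ‖G x‖ ≤ C) (hGF : EqOn G F X) (hX : IsClosed X) :
    MeasurableSet (mpiSet F X) := by
  have : mpiSet F X = interior X \ mpiCompl F X :=
    (sdiff_sdiff_cancel_left fun x hx => hx.1).symm
  rw [this]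
  exact isOpen_interior.measurableSet.diff (hφ.measurableSet_mpiCompl hK hC hGF hX)

end LocalSolutions

/-! ### The exit measures are feasible -/

section Feasible

variable {n : ℕ} {F G : State n → State n} {φ : ℝ → State n → State n} {K C : ℝ≥0}
  {X : Set (State n)}

/-- The part `{(x, s) | x ∈ A, 0 < s ≤ τ x}` of space-time below the graph of `τ`. -/
def belowGraph {α : Type*} (A : Set α) (τ : α → ℝ≥0∞) : Set (α × ℝ) :=
  {p | p.1 ∈ A ∧ 0 < p.2 ∧ ENNReal.ofReal p.2 ≤ τ p.1}

theorem measurableSet_belowGraph {α : Type*} [MeasurableSpace α] {A : Set α} {τ : α → ℝ≥0∞}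
    (hA : MeasurableSet A) (hτ : Measurable τ) : MeasurableSet (belowGraph A τ) :=
  (measurable_fst hA).inter ((measurableSet_lt measurable_const measurable_snd).inter
    (measurableSet_le (ENNReal.measurable_ofReal.comp measurable_snd) (hτ.comp measurable_fst)))

theorem mk_preimage_belowGraph {α : Type*} {A : Set α} {τ : α → ℝ≥0∞} {x : α} (hx : x ∈ A)
    (h : τ x ≠ ⊤) : Prod.mk x ⁻¹' belowGraph A τ = Ioc 0 (τ x).toReal := by
  ext s
  simp only [belowGraph, mem_preimage, mem_ofPred_eq, hx, true_and, mem_Ioc]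
  refine and_congr_right fun hs => ?_
  rw [← ENNReal.ofReal_toReal h, ENNReal.ofReal_le_ofReal_iff ENNReal.toReal_nonneg,
    ENNReal.ofReal_toReal h]

theorem mk_preimage_belowGraph_of_notMem {α : Type*} {A : Set α} {τ : α → ℝ≥0∞} {x : α}
    (hx : x ∉ A) : Prod.mk x ⁻¹' belowGraph A τ = ∅ :=
  eq_empty_of_forall_notMem fun _ hs => hx hs.1

/-- The quadruplet of Lebesgue measure on `mpiCompl F X`: the slack on the rest of `X`, the time
spent in `X` before the exit, and the distribution of the exit point. -/
noncomputable def exitQuadruplet (F : State n → State n) (φ : ℝ → State n → State n)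
    (X : Set (State n)) : Quadruplet n where
  μ₀ := volume.restrict (mpiCompl F X)
  μ₀hat := volume.restrict (X \ mpiCompl F X)
  μ := (((volume : Measure (State n)).prod (volume : Measure ℝ)).restrict
    (belowGraph (mpiCompl F X) (flowExitTime φ (interior X)))).map fun p => φ p.2 p.1
  μbd := (volume.restrict (mpiCompl F X)).map fun x => φ (flowExitTime φ (interior X) x).toReal x

theorem mpiCompl_subset : mpiCompl F X ⊆ X := fun _ hx => interior_subset hx.1

theorem IsGlobalFlow.mem_of_mem_mpiCompl (hφ : IsGlobalFlow G φ) (hK : LipschitzWith K G)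
    (hGF : EqOn G F X) (hX : IsClosed X) {x : State n} (hx : x ∈ mpiCompl F X) {s : ℝ}
    (hs : s ∈ Icc 0 (flowExitTime φ (interior X) x).toReal) : φ s x ∈ X := by
  have hx' := (hφ.mem_mpiCompl_iff hK hGF hX).1 hx
  exact mem_of_forall_mem_interior hX (hφ.continuous_time x).continuousOn
    (by rw [hφ.zero]; exact interior_subset hx'.1)
    (hφ.mem_of_lt_flowExitTime isOpen_interior hx'.2) s hs

theorem IsGlobalFlow.mem_of_mem_belowGraph (hφ : IsGlobalFlow G φ) (hK : LipschitzWith K G)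
    (hGF : EqOn G F X) (hX : IsClosed X) {p : State n × ℝ}
    (hp : p ∈ belowGraph (mpiCompl F X) (flowExitTime φ (interior X))) : φ p.2 p.1 ∈ X := by
  have hx' := (hφ.mem_mpiCompl_iff hK hGF hX).1 hp.1
  have hs : p.2 ∈ Prod.mk p.1 ⁻¹' belowGraph (mpiCompl F X) (flowExitTime φ (interior X)) := hp
  rw [mk_preimage_belowGraph hp.1 hx'.2] at hs
  exact hφ.mem_of_mem_mpiCompl hK hGF hX hp.1 (Ioc_subset_Icc_self hs)

theorem IsGlobalFlow.prod_belowGraph (hφ : IsGlobalFlow G φ) (hK : LipschitzWith K G)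
    (hC : ∀ x, ‖G x‖ ≤ C) (hGF : EqOn G F X) (hX : IsClosed X) :
    ((volume : Measure (State n)).prod (volume : Measure ℝ))
      (belowGraph (mpiCompl F X) (flowExitTime φ (interior X))) =
      ∫⁻ x in mpiCompl F X, exitTime F X x := by
  have hA := hφ.measurableSet_mpiCompl hK hC hGF hX
  have hτ := hφ.measurable_flowExitTime hK hC (isOpen_interior (s := X))
  rw [Measure.prod_apply (measurableSet_belowGraph hA hτ), ← lintegral_indicator hA]
  refine lintegral_congr fun x => ?_
  by_cases hx : x ∈ mpiCompl F X
  · have hx' := (hφ.mem_mpiCompl_iff hK hGF hX).1 hx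
    rw [mk_preimage_belowGraph hx hx'.2, Real.volume_Ioc, sub_zero, ENNReal.ofReal_toReal hx'.2,
      indicator_of_mem hx, hφ.exitTime_eq hK hGF hX hx'.1]
  · rw [mk_preimage_belowGraph_of_notMem hx, indicator_of_notMem hx, measure_empty]

theorem restrict_apply_eq_zero_of_disjoint {α : Type*} [MeasurableSpace α] {ν : Measure α}
    {A S : Set α} (hA : MeasurableSet A) (h : ∀ x ∈ A, x ∉ S) : ν.restrict A S = 0 := by
  rw [Measure.restrict_apply' hA, (disjoint_right.2 h).inter_eq, measure_empty]

/-- The divergence equation for the exit measures, by integrating the fundamental theorem of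
calculus along each trajectory, from its start to its exit point. -/
theorem IsGlobalFlow.exitQuadruplet_div_eq (hφ : IsGlobalFlow G φ) (hK : LipschitzWith K G)
    (hC : ∀ x, ‖G x‖ ≤ C) (hF : Continuous F) (hGF : EqOn G F X) (hX : IsCompact X)
    (hfin : ∫⁻ x in mpiCompl F X, exitTime F X x ≠ ⊤) {v : State n → ℝ} (hv : ContDiff ℝ 1 v) :
    -(∫ x, fderiv ℝ v x (F x) ∂(exitQuadruplet F φ X).μ) + ∫ x, v x ∂(exitQuadruplet F φ X).μbd =
      ∫ x, v x ∂(exitQuadruplet F φ X).μ₀ := by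
  have hXc := hX.isClosed
  have hA := hφ.measurableSet_mpiCompl hK hC hGF hXc
  have hτ := hφ.measurable_flowExitTime hK hC (isOpen_interior (s := X))
  set A := mpiCompl F X with hAdef
  set τ := flowExitTime φ (interior X) with hτdef
  set Γ := belowGraph A τ with hΓ
  have hΓm : MeasurableSet Γ := measurableSet_belowGraph hA hτ
  have hφc : Continuous fun p : State n × ℝ => φ p.2 p.1 :=
    (hφ.continuous_uncurry hK hC).comp continuous_swap
  have hdc : Continuous fun x => fderiv ℝ v x (F x) :=
    (hv.continuous_fderiv one_ne_zero).clm_apply hF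
  have hAfin : volume A ≠ ⊤ :=
    ne_top_of_le_ne_top hX.measure_lt_top.ne (measure_mono mpiCompl_subset)
  have hexit : Measurable fun x => φ (τ x).toReal x :=
    (hφ.continuous_uncurry hK hC).measurable.comp (hτ.ennreal_toReal.prodMk measurable_id)
  obtain ⟨B, hB⟩ := hX.exists_bound_of_continuousOn hdc.continuousOn
  obtain ⟨B', hB'⟩ := hX.exists_bound_of_continuousOn hv.continuous.continuousOn
  -- the space-time integral, slice by slice
  have hint : IntegrableOn (fun p : State n × ℝ => fderiv ℝ v (φ p.2 p.1) (F (φ p.2 p.1))) Γ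
      ((volume : Measure (State n)).prod volume) := by
    refine Measure.integrableOn_of_bounded (M := B) ?_ (hdc.comp hφc).aestronglyMeasurable ?_
    · rw [hφ.prod_belowGraph hK hC hGF hXc]; exact hfin
    · exact (ae_restrict_iff' hΓm).2 (.of_forall fun p hp =>
        hB _ (hφ.mem_of_mem_belowGraph hK hGF hXc hp))
  have hslice : ∀ x, ∫ s, Γ.indicator
      (fun p : State n × ℝ => fderiv ℝ v (φ p.2 p.1) (F (φ p.2 p.1))) (x, s) =
      A.indicator (fun x => v (φ (τ x).toReal x) - v x) x := by
    intro x
    by_cases hx : x ∈ A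
    · have hx' := (hφ.mem_mpiCompl_iff hK hGF hXc).1 hx
      have h1 : ∀ s, Γ.indicator
          (fun p : State n × ℝ => fderiv ℝ v (φ p.2 p.1) (F (φ p.2 p.1))) (x, s) =
          (Ioc 0 (τ x).toReal).indicator (fun s => fderiv ℝ v (φ s x) (F (φ s x))) s := by
        intro s
        rw [← mk_preimage_belowGraph hx hx'.2]
        rfl
      simp_rw [h1]
      rw [integral_indicator measurableSet_Ioc,
        ← intervalIntegral.integral_of_le ENNReal.toReal_nonneg, indicator_of_mem hx]
      have h2 := intervalIntegral.integral_eq_sub_of_hasDerivAt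
        (f := fun s => v (φ s x)) (f' := fun s => fderiv ℝ v (φ s x) (F (φ s x)))
        (a := 0) (b := (τ x).toReal) (fun s hs => ?_)
        ((hdc.comp (hφ.continuous_time x)).intervalIntegrable _ _)
      · rw [h2, hφ.zero]
      · rw [uIcc_of_le ENNReal.toReal_nonneg] at hs
        have h3 := (hv.differentiable one_ne_zero (φ s x)).hasFDerivAt.comp_hasDerivAt s
          (hφ.isIntegralCurve x s)
        simpa only [hGF (hφ.mem_of_mem_mpiCompl hK hGF hXc hx hs)] using! h3
    · rw [indicator_of_notMem hx]
      have h1 : ∀ s, Γ.indicator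
          (fun p : State n × ℝ => fderiv ℝ v (φ p.2 p.1) (F (φ p.2 p.1))) (x, s) = 0 :=
        fun s => indicator_of_notMem (fun hs => hx hs.1) _
      simp [h1]
  have hμ : ∫ x, fderiv ℝ v x (F x) ∂(exitQuadruplet F φ X).μ =
      ∫ x in A, (v (φ (τ x).toReal x) - v x) := by
    change ∫ x, fderiv ℝ v x (F x) ∂(Measure.map _ _) = _
    rw [integral_map hφc.measurable.aemeasurable hdc.aestronglyMeasurable,
      ← integral_indicator hΓm, integral_prod _ ((integrable_indicator_iff hΓm).2 hint),
      ← integral_indicator hA]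
    exact integral_congr_ae (.of_forall hslice)
  have hbd : ∫ x, v x ∂(exitQuadruplet F φ X).μbd = ∫ x in A, v (φ (τ x).toReal x) :=
    integral_map hexit.aemeasurable hv.continuous.aestronglyMeasurable
  have i1 : IntegrableOn (fun x => v (φ (τ x).toReal x)) A := by
    refine Measure.integrableOn_of_bounded (M := B') hAfin
      (hv.continuous.measurable.comp hexit).aestronglyMeasurable
      ((ae_restrict_iff' hA).2 (.of_forall fun x hx => hB' _
        (hφ.mem_of_mem_mpiCompl hK hGF hXc hx (right_mem_Icc.2 ENNReal.toReal_nonneg))))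
  have i2 : IntegrableOn v A :=
    (hv.continuous.continuousOn.integrableOn_compact hX).mono_set mpiCompl_subset
  rw [hμ, hbd, integral_sub i1 i2]
  change _ = ∫ x in A, v x
  ring

theorem IsGlobalFlow.feasible_exitQuadruplet (hφ : IsGlobalFlow G φ) (hK : LipschitzWith K G)
    (hC : ∀ x, ‖G x‖ ≤ C) (hF : Continuous F) (hGF : EqOn G F X) (hX : IsCompact X) {T : ℝ≥0}
    (hT : ∫⁻ x in mpiCompl F X, exitTime F X x ≤ T * volume X) :
    Feasible F X T (exitQuadruplet F φ X) := by
  have hXc := hX.isClosed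
  have hA := hφ.measurableSet_mpiCompl hK hC hGF hXc
  have hτ := hφ.measurable_flowExitTime hK hC (isOpen_interior (s := X))
  have hφc : Continuous fun p : State n × ℝ => φ p.2 p.1 :=
    (hφ.continuous_uncurry hK hC).comp continuous_swap
  have hexit : Measurable fun x => φ (flowExitTime φ (interior X) x).toReal x :=
    (hφ.continuous_uncurry hK hC).measurable.comp (hτ.ennreal_toReal.prodMk measurable_id)
  have hXfin : volume X ≠ ⊤ := hX.measure_lt_top.ne
  have hfin : ∫⁻ x in mpiCompl F X, exitTime F X x ≠ ⊤ :=
    ne_top_of_le_ne_top (ENNReal.mul_ne_top ENNReal.coe_ne_top hXfin) hT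
  have hμ₀ : IsFiniteMeasure ((volume : Measure (State n)).restrict (mpiCompl F X)) :=
    isFiniteMeasure_restrict.2 (ne_top_of_le_ne_top hXfin (measure_mono mpiCompl_subset))
  have hμ : IsFiniteMeasure (((volume : Measure (State n)).prod (volume : Measure ℝ)).restrict
      (belowGraph (mpiCompl F X) (flowExitTime φ (interior X)))) :=
    isFiniteMeasure_restrict.2 (by rwa [hφ.prod_belowGraph hK hC hGF hXc])
  refine ⟨hμ₀, isFiniteMeasure_restrict.2 (ne_top_of_le_ne_top hXfin (measure_mono sdiff_subset)),
    Measure.isFiniteMeasure_map _ _, Measure.isFiniteMeasure_map _ _, ?_, ?_, ?_, ?_,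
    fun v hv => hφ.exitQuadruplet_div_eq hK hC hF hGF hX hfin hv, ?_, ?_⟩
  · exact restrict_apply_eq_zero_of_disjoint hA fun x hx hxX => hxX (mpiCompl_subset hx)
  · exact restrict_apply_eq_zero_of_disjoint (hXc.measurableSet.diff hA)
      fun x hx hxX => hxX hx.1
  · have hΓm := measurableSet_belowGraph hA hτ
    change Measure.map _ _ Xᶜ = 0
    rw [Measure.map_apply hφc.measurable hXc.measurableSet.compl]
    exact restrict_apply_eq_zero_of_disjoint hΓm fun p hp hpX =>
      hpX (hφ.mem_of_mem_belowGraph hK hGF hXc hp)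
  · have hbm : MeasurableSet (boundary X) := hXc.measurableSet.diff isOpen_interior.measurableSet
    change Measure.map _ _ (boundary X)ᶜ = 0
    rw [Measure.map_apply hexit hbm.compl]
    refine restrict_apply_eq_zero_of_disjoint hA fun x hx hxb => hxb ⟨?_, ?_⟩
    · exact hφ.mem_of_mem_mpiCompl hK hGF hXc hx (right_mem_Icc.2 ENNReal.toReal_nonneg)
    · exact hφ.apply_flowExitTime_notMem isOpen_interior ((hφ.mem_mpiCompl_iff hK hGF hXc).1 hx).2
  · change volume.restrict (mpiCompl F X) + volume.restrict (X \ mpiCompl F X) = volume.restrict X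
    rw [← Measure.restrict_union disjoint_sdiff_right (hXc.measurableSet.diff hA),
      union_sdiff_cancel mpiCompl_subset]
  · change Measure.map _ _ X ≤ _
    rw [Measure.map_apply hφc.measurable hXc.measurableSet]
    refine (measure_mono (subset_univ _)).trans ?_
    rw [Measure.restrict_apply_univ, hφ.prod_belowGraph hK hC hGF hXc]
    exact hT

end Feasible

/-! ### Every feasible initial measure is carried by `mpiCompl` -/

section Upper

variable {n : ℕ} {F G : State n → State n} {φ : ℝ → State n → State n} {K C L : ℝ≥0}
  {X : Set (State n)} {T : ℝ≥0} {q : Quadruplet n}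

theorem IsGlobalFlow.feasible_mpiSet_eq_zero (hφ : IsGlobalFlow G φ) (hG : ContDiff ℝ 1 G)
    (hK : LipschitzWith K G) (hC : ∀ x, ‖G x‖ ≤ C)
    (hDG : ∀ x y, ‖fderiv ℝ G x - fderiv ℝ G y‖ ≤ L * ‖x - y‖) (hGF : EqOn G F X)
    (hX : IsClosed X) (hq : Feasible F X T q) : q.μ₀ (mpiSet F X) = 0 := by
  have := hq.finite_μ
  have := hq.finite_μ₀
  have := hq.finite_μbd
  refine hφ.source_eq_zero_of_forwardInvariant (μ := q.μ) (ν₁ := q.μbd) hG hK L.coe_nonneg hDG hC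
    (fun w hw => ?_) (hφ.measurableSet_mpiSet hK hC hGF hX) (fun s hs x hx => ?_) (fun x hx => ?_)
    ?_
  · rw [← hq.div_eq w hw]
    congr 2
    refine integral_congr_ae ?_
    filter_upwards [mem_ae_iff.2 hq.supp_μ] with x hx
    rw [hGF hx]
  · rw [hφ.mem_mpiSet_iff hK hGF hX] at hx ⊢
    intro r hr
    rw [← hφ.add hK]
    exact hx _ (add_nonneg hr hs)
  · rw [hφ.mem_mpiSet_iff hK hGF hX] at hx
    -- the trajectory stays in the open set `interior X` for a short time in the past
    have h0 : φ 0 x ∈ interior X := hx 0 le_rfl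
    have hev := (hφ.continuous_time x).continuousAt.eventually (isOpen_interior.mem_nhds h0)
    obtain ⟨ε, hε, hball⟩ := Metric.eventually_nhds_iff.1 hev
    refine ⟨ε / 2, by positivity, (hφ.mem_mpiSet_iff hK hGF hX).2 fun r hr => ?_⟩
    rw [← hφ.add hK]
    rcases le_total 0 (r + -(ε / 2)) with h | h
    · exact hx _ h
    · refine hball ?_
      rw [Real.dist_eq, sub_zero, abs_of_nonpos h]
      linarith
  · exact measure_mono_null (t := (boundary X)ᶜ) (fun x hx hxb => hxb.2 hx.1) hq.supp_μbd

theorem feasible_le_volume_restrict_mpiCompl (hbd : volume (boundary X) = 0)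
    (hA : MeasurableSet (mpiCompl F X)) (hq : Feasible F X T q) (h0 : q.μ₀ (mpiSet F X) = 0) :
    q.μ₀ ≤ volume.restrict (mpiCompl F X) := by
  have hle : q.μ₀ ≤ volume.restrict X := hq.add_eq ▸ Measure.le_add_right le_rfl
  have hbd0 : q.μ₀ (boundary X) = 0 :=
    nonpos_iff_eq_zero.1 ((hle _).trans ((Measure.restrict_apply_le _ _).trans hbd.le))
  have hcompl : q.μ₀ (mpiCompl F X)ᶜ = 0 := by
    refine measure_mono_null (t := Xᶜ ∪ (boundary X ∪ mpiSet F X)) (fun x hx => ?_)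
      (measure_union_null hq.supp_μ₀ (measure_union_null hbd0 h0))
    by_cases h1 : x ∈ X
    · by_cases h2 : x ∈ interior X
      · by_cases h3 : x ∈ mpiSet F X
        · exact .inr (.inr h3)
        · exact absurd ⟨h2, h3⟩ hx
      · exact .inr (.inl ⟨h1, h2⟩)
    · exact .inl h1
  calc q.μ₀ = q.μ₀.restrict (mpiCompl F X) :=
        (Measure.restrict_eq_self_of_ae_mem (mem_ae_iff.2 hcompl)).symm
    _ ≤ (volume.restrict X).restrict (mpiCompl F X) := Measure.restrict_mono_measure hle _
    _ = volume.restrict (mpiCompl F X) := by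
        rw [Measure.restrict_restrict hA, inter_eq_left.2 mpiCompl_subset]

end Upper

/-! ### Optimality -/

theorem measure_eq_of_le_of_univ_eq {α : Type*} [MeasurableSpace α] {μ ν : Measure α}
    [IsFiniteMeasure ν] (hle : μ ≤ ν) (huniv : μ univ = ν univ) : μ = ν := by
  have : IsFiniteMeasure μ := isFiniteMeasure_of_le ν hle
  refine Measure.ext fun S hS => (hle S).antisymm ?_
  have h1 : ν S + ν Sᶜ ≤ μ S + ν Sᶜ := by
    rw [measure_add_measure_compl hS, ← huniv, ← measure_add_measure_compl hS]
    gcongr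
  exact (ENNReal.add_le_add_iff_right (measure_ne_top ν Sᶜ)).1 h1

theorem lintegral_exitTime_le {n : ℕ} {F : State n → State n} {X : Set (State n)}
    (hX : IsCompact X) {T : ℝ≥0} (hT : meanExitTime F X ≤ T) :
    ∫⁻ x in mpiCompl F X, exitTime F X x ≤ T * volume X := by
  by_cases h0 : volume X = 0
  · rw [setLIntegral_measure_zero _ _ (measure_mono_null mpiCompl_subset h0)]
    exact zero_le
  · exact (ENNReal.div_le_iff h0 hX.measure_lt_top.ne).1 hT

end MPI

theorem theorem3 {n m : ℕ} (f : Fin n → MvPolynomial (Fin n) ℝ)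
    (g : Fin m → MvPolynomial (Fin n) ℝ)
    (hne : (MPI.semialgebraicSet g).Nonempty)
    (hcompact : IsCompact (MPI.semialgebraicSet g))
    (hfinite : MPI.meanExitTime (MPI.vectorField f) (MPI.semialgebraicSet g) < ⊤)
    (henter : MPI.StrictlyEnters (MPI.vectorField f) (MPI.semialgebraicSet g))
    (T : ℝ≥0)
    (hT : MPI.meanExitTime (MPI.vectorField f) (MPI.semialgebraicSet g) ≤ (T : ℝ≥0∞)) :
    MPI.primalValue (MPI.vectorField f) (MPI.semialgebraicSet g) T =
        volume (MPI.mpiCompl (MPI.vectorField f) (MPI.semialgebraicSet g)) ∧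
      (∃ q : MPI.Quadruplet n,
        MPI.IsOptimal (MPI.vectorField f) (MPI.semialgebraicSet g) T q) ∧
      ∀ q : MPI.Quadruplet n,
        MPI.IsOptimal (MPI.vectorField f) (MPI.semialgebraicSet g) T q →
          q.μ₀ = volume.restrict (MPI.mpiCompl (MPI.vectorField f) (MPI.semialgebraicSet g)) := by
  have hbd := MPI.volume_boundary_semialgebraicSet g
  set X := MPI.semialgebraicSet g with hXdef
  set F := MPI.vectorField f with hFdef
  have hF : ContDiff ℝ 2 F := MPI.contDiff_vectorField f
  obtain ⟨G, K, C, L, hG, hK, hC, hDG, hGF⟩ := MPI.exists_cutoff hF hcompact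
  obtain ⟨φ, hφ⟩ := MPI.exists_isGlobalFlow hK hC
  have hclosed := hcompact.isClosed
  have hA := hφ.measurableSet_mpiCompl hK hC hGF hclosed
  have hAX : MPI.mpiCompl F X ⊆ X := MPI.mpiCompl_subset
  have hupper : ∀ q, MPI.Feasible F X T q → q.μ₀ ≤ volume.restrict (MPI.mpiCompl F X) :=
    fun q hq => MPI.feasible_le_volume_restrict_mpiCompl hbd hA hq
      (hφ.feasible_mpiSet_eq_zero hG hK hC hDG hGF hclosed hq)
  have hfeas : MPI.Feasible F X T (MPI.exitQuadruplet F φ X) :=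
    hφ.feasible_exitQuadruplet hK hC hF.continuous hGF hcompact
      (MPI.lintegral_exitTime_le hcompact hT)
  have hrestrict : volume.restrict (MPI.mpiCompl F X) X = volume (MPI.mpiCompl F X) := by
    rw [Measure.restrict_apply hclosed.measurableSet, inter_eq_right.2 hAX]
  have hvalue : MPI.primalValue F X T = volume (MPI.mpiCompl F X) := by
    apply le_antisymm
    · refine sSup_le ?_
      rintro _ ⟨q, hq, rfl⟩
      exact (hupper q hq X).trans_eq hrestrict
    · exact le_sSup ⟨_, hfeas, hrestrict⟩
  refine ⟨hvalue, ⟨_, hfeas, hrestrict.trans hvalue.symm⟩, fun q ⟨hq, hopt⟩ => ?_⟩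
  have : IsFiniteMeasure ((volume : Measure (MPI.State n)).restrict (MPI.mpiCompl F X)) :=
    isFiniteMeasure_restrict.2
      (ne_top_of_le_ne_top hcompact.measure_lt_top.ne (measure_mono hAX))
  refine MPI.measure_eq_of_le_of_univ_eq (hupper q hq) ?_
  rw [Measure.restrict_apply_univ, ← hvalue, ← hopt,
    ← measure_add_measure_compl hclosed.measurableSet, hq.supp_μ₀, add_zero]
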